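/- Let $\mathbb T^2=\mathbb R^2/\mathbb Z^2$, let $W^{1,\infty}(\mathbb T^2)$ be the space of real $f\in L^\infty(\mathbb T^2)$ with weak gradient $\nabla f\in L^\infty$, normed by $\|f\|_{W^{1,\infty}}=\max(\|f\|_{L^\infty},\|\nabla f\|_{L^\infty})$, and for $t>0$ let $e^{-t\Delta^2}$ be the Fourier multiplier with symbol $e^{-t(2\pi|k|)^4}$, $k\in\mathbb Z^2$. For $u_0\in W^{1,\infty}(\mathbb T^2)$ and $T>0$, a mild solution on $(0,T]$ of $$\partial_t u+\Delta^2u=-\nabla\cdot(|\nabla u|^{p-2}\nabla u),\qquad u(0)=u_0,$$ is a function $u\in C((0,T];W^{1,\infty}(\mathbb T^2))$ such that for every $0<t\le T$ $$u(t)=e^{-t\Delta^2}u_0-\int_0^t\nabla\cdot e^{-(t-s)\Delta^2}\big(|\nabla u(s)|^{p-2}\nabla u(s)\big)\,ds$$ holds in $W^{1,\infty}(\mathbb T^2)$, the integral being a (convergent) Bochner integral in $W^{1,\infty}(\mathbb T^2)$. **Theorem.** Let $2<p<3$ and $M\in\mathbb R$. There is $0<T\le 1$, depending only on $p$ and $M$,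 such that for every $u_0\in W^{1,\infty}(\mathbb T^2)$ with $\|u_0\|_{W^{1,\infty}}\le M$ the equation has a mild solution $u$ on $(0,T]$ with $\sup_{0<t\le T}\|u(t)\|_{W^{1,\infty}}<\infty$. With $u(0):=u_0$, this solution belongs to $C([0,T];L^\infty(\mathbb T^2))$, and to $C([0,T];W^{1,\infty}(\mathbb T^2))$ if $u_0\in C^1(\mathbb T^2)$. It is unique: every mild solution $v$ on $(0,T]$ with the same initial data and $\sup_{0<t\le T}\|v(t)\|_{W^{1,\infty}}<\infty$ (in particular every one that extends to an element of $C([0,T];W^{1,\infty}(\mathbb T^2))$) equals $u$ on $(0,T]$. -/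

import Mathlib

open MeasureTheory Set Filter Topology
open scoped ENNReal ContDiff

noncomputable section

namespace ThinFilm

/-- The two-dimensional torus `ℝ² / ℤ²`. -/
abbrev T2 : Type := UnitAddTorus (Fin 2)

/-- Euclidean `ℝ²`, where gradients take their values. -/
abbrev E2 : Type := EuclideanSpace ℝ (Fin 2)

/-- Lebesgue measure on the torus, of total mass one. -/
def vol : Measure T2 := Measure.pi fun _ => AddCircle.haarAddCircle

instance : IsProbabilityMeasure vol := by
  unfold vol; infer_instance

/-- The covering map `ℝ² → T²`. -/
def proj (y : Fin 2 → ℝ) : T2 := fun i => (y i : UnitAddCircle)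

/-- Smooth functions on the torus: those whose periodic lift to `ℝ²` is smooth. -/
def IsSmooth (φ : T2 → ℝ) : Prop := ContDiff ℝ ∞ fun y => φ (proj y)

/-- The classical partial derivative `∂ᵢ φ` on the torus. -/
def partialD (i : Fin 2) (φ : T2 → ℝ) (x : T2) : ℝ :=
  deriv (fun h : ℝ => φ (x + Pi.single i (h : UnitAddCircle))) 0

/-- `g` is the weak gradient of `f`: `∫ f ∂ᵢφ = - ∫ gᵢ φ` for all smooth `φ` and `i = 1, 2`. -/
def IsWeakGradient (f : T2 → ℝ) (g : T2 → E2) : Prop :=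
  ∀ (i : Fin 2) (φ : T2 → ℝ), IsSmooth φ →
    ∫ x, f x * partialD i φ x ∂vol = - ∫ x, g x i * φ x ∂vol

/-! Smooth functions and their partial derivatives are continuous on the torus. -/

theorem isOpenQuotientMap_proj : IsOpenQuotientMap proj :=
  IsOpenQuotientMap.piMap (fun _ => QuotientAddGroup.isOpenQuotientMap_mk)

theorem IsSmooth.continuous {φ : T2 → ℝ} (h : IsSmooth φ) : Continuous φ :=
  isOpenQuotientMap_proj.isQuotientMap.continuous_iff.2 (ContDiff.continuous h)

theorem partialD_proj {φ : T2 → ℝ} (h : IsSmooth φ) (i : Fin 2) (y : Fin 2 → ℝ) :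
    partialD i φ (proj y) = fderiv ℝ (fun y => φ (proj y)) y (Pi.single i 1) := by
  have hd : HasFDerivAt (fun y => φ (proj y)) (fderiv ℝ (fun y => φ (proj y)) y) y :=
    ((ContDiff.differentiable h (by simp)) y).hasFDerivAt
  have hl : HasLineDerivAt ℝ (fun y => φ (proj y))
      (fderiv ℝ (fun y => φ (proj y)) y (Pi.single i 1)) y (Pi.single i 1) :=
    hd.hasLineDerivAt _
  have : (fun h : ℝ => φ (proj y + Pi.single i (h : UnitAddCircle)))
      = fun t : ℝ => φ (proj (y + t • Pi.single i 1)) := by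
    funext t
    congr 1
    funext j
    by_cases hj : j = i
    · subst hj; simp [proj]
    · simp [proj, hj]
  unfold partialD
  rw [this]
  exact hl.deriv

theorem IsSmooth.continuous_partialD {φ : T2 → ℝ} (h : IsSmooth φ) (i : Fin 2) :
    Continuous (partialD i φ) := by
  refine isOpenQuotientMap_proj.isQuotientMap.continuous_iff.2 ?_
  have : partialD i φ ∘ proj = fun y => fderiv ℝ (fun y => φ (proj y)) y (Pi.single i 1) :=
    funext fun y => partialD_proj h i y
  rw [this]
  exact (ContDiff.continuous_fderiv h (by simp)).clm_apply continuous_const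

/-! Testing an essentially bounded function against a continuous one. -/

theorem integrable_mul {f h : T2 → ℝ} (hf : MemLp f ∞ vol) (hh : Continuous h) :
    Integrable (fun x => f x * h x) vol := by
  obtain ⟨C, hC⟩ := isCompact_univ.exists_bound_of_continuousOn hh.continuousOn
  exact (hf.integrable le_top).mul_bdd (c := C) hh.aestronglyMeasurable
    (Eventually.of_forall fun x => hC x (mem_univ x))

theorem continuous_pairing {F : Type*} [NormedAddCommGroup F] [NormedSpace ℝ F]
    (L : F →L[ℝ] ℝ) {h : T2 → ℝ} (hh : Continuous h) :
    Continuous fun f : Lp F ∞ vol => ∫ x, L (f x) * h x ∂vol := by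
  obtain ⟨C, hC⟩ := isCompact_univ.exists_bound_of_continuousOn hh.continuousOn
  have hint : ∀ f : Lp F ∞ vol, Integrable (fun x => L (f x) * h x) vol := fun f =>
    integrable_mul (L.comp_memLp' (Lp.memLp f)) hh
  let A : Lp F ∞ vol →ₗ[ℝ] ℝ :=
    { toFun := fun f => ∫ x, L (f x) * h x ∂vol
      map_add' := fun f g => by
        rw [← integral_add (hint f) (hint g)]
        refine integral_congr_ae ?_
        filter_upwards [Lp.coeFn_add f g] with x hx
        simp only [hx, Pi.add_apply, map_add, add_mul]
      map_smul' := fun c f => by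
        rw [RingHom.id_apply, smul_eq_mul, ← integral_const_mul]
        refine integral_congr_ae ?_
        filter_upwards [Lp.coeFn_smul c f] with x hx
        simp [hx, mul_assoc] }
  refine (A.mkContinuous (‖L‖ * C) fun f => ?_).continuous
  have hb : ∀ᵐ x ∂vol, ‖L (f x) * h x‖ ≤ ‖L‖ * C * ‖f‖ := by
    have hf : ∀ᵐ x ∂vol, ‖f x‖ ≤ ‖f‖ := by
      filter_upwards [ae_le_eLpNormEssSup (f := f) (μ := vol)] with x hx
      rw [Lp.norm_def, eLpNorm_exponent_top, ← toReal_enorm]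
      exact ENNReal.toReal_mono (by simpa using Lp.eLpNorm_ne_top f) hx
    filter_upwards [hf] with x hx
    rw [norm_mul]
    calc ‖L (f x)‖ * ‖h x‖ ≤ (‖L‖ * ‖f‖) * C := by
          gcongr
          · exact L.le_of_opNorm_le_of_le le_rfl hx
          · exact hC x (mem_univ x)
      _ = ‖L‖ * C * ‖f‖ := by ring
  have := norm_integral_le_of_norm_le_const hb
  rwa [probReal_univ, mul_one] at this

/-- The Sobolev space `W^{1,∞}(T²)`: pairs `(f, ∇f)` of an essentially bounded real function and
its essentially bounded weak gradient (which `f` determines), with the norm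
`max (‖f‖_{L^∞}) (‖∇f‖_{L^∞})`. -/
def W1Inf : Submodule ℝ (Lp ℝ ∞ vol × Lp E2 ∞ vol) where
  carrier := {w | IsWeakGradient w.1 w.2}
  zero_mem' := by
    intro i φ hφ
    have h1 : ∫ x, (0 : Lp ℝ ∞ vol) x * partialD i φ x ∂vol = 0 := by
      simp
    have h2 : ∫ x, (0 : Lp E2 ∞ vol) x i * φ x ∂vol = 0 := by
      simp
    simp only [Prod.fst_zero, Prod.snd_zero, h1, h2, neg_zero]
  add_mem' := by
    intro v w hv hw i φ hφ
    have hL : ∀ g : Lp E2 ∞ vol, MemLp (fun x => g x i) ∞ vol := fun g =>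
      (EuclideanSpace.proj (𝕜 := ℝ) i).comp_memLp' (Lp.memLp g)
    have h1 : ∫ x, (v + w).1 x * partialD i φ x ∂vol
        = ∫ x, v.1 x * partialD i φ x ∂vol + ∫ x, w.1 x * partialD i φ x ∂vol := by
      rw [← integral_add (integrable_mul (Lp.memLp _) (hφ.continuous_partialD i))
        (integrable_mul (Lp.memLp _) (hφ.continuous_partialD i))]
      refine integral_congr_ae ?_
      filter_upwards [Lp.coeFn_add v.1 w.1] with x hx
      simp only [Prod.fst_add, hx, Pi.add_apply, add_mul]
    have h2 : ∫ x, (v + w).2 x i * φ x ∂vol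
        = ∫ x, v.2 x i * φ x ∂vol + ∫ x, w.2 x i * φ x ∂vol := by
      rw [← integral_add (integrable_mul (hL _) hφ.continuous)
        (integrable_mul (hL _) hφ.continuous)]
      refine integral_congr_ae ?_
      filter_upwards [Lp.coeFn_add v.2 w.2] with x hx
      simp only [Prod.snd_add, hx, Pi.add_apply, PiLp.add_apply, add_mul]
    rw [h1, h2, hv i φ hφ, hw i φ hφ]
    ring
  smul_mem' := by
    intro c w hw i φ hφ
    have h1 : ∫ x, (c • w).1 x * partialD i φ x ∂vol
        = c * ∫ x, w.1 x * partialD i φ x ∂vol := by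
      rw [← integral_const_mul]
      refine integral_congr_ae ?_
      filter_upwards [Lp.coeFn_smul c w.1] with x hx
      simp [hx, mul_assoc]
    have h2 : ∫ x, (c • w).2 x i * φ x ∂vol = c * ∫ x, w.2 x i * φ x ∂vol := by
      rw [← integral_const_mul]
      refine integral_congr_ae ?_
      filter_upwards [Lp.coeFn_smul c w.2] with x hx
      simp [hx, mul_assoc]
    rw [h1, h2, hw i φ hφ]
    ring

/-- The class in `L^∞` of an element of `W^{1,∞}`. -/
def fn (w : W1Inf) : Lp ℝ ∞ vol := w.1.1

/-- The weak gradient of an element of `W^{1,∞}`. -/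
def grad (w : W1Inf) : Lp E2 ∞ vol := w.1.2

theorem isClosed_W1Inf : IsClosed (W1Inf : Set (Lp ℝ ∞ vol × Lp E2 ∞ vol)) := by
  have : (W1Inf : Set (Lp ℝ ∞ vol × Lp E2 ∞ vol))
      = ⋂ (i : Fin 2) (φ : T2 → ℝ) (_ : IsSmooth φ),
        {w | ∫ x, w.1 x * partialD i φ x ∂vol = - ∫ x, w.2 x i * φ x ∂vol} := by
    ext w
    simp only [mem_iInter]
    exact Iff.rfl
  rw [this]
  refine isClosed_iInter fun i => isClosed_iInter fun φ => isClosed_iInter fun hφ => ?_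
  refine isClosed_eq ?_ ?_
  · exact (continuous_pairing (ContinuousLinearMap.id ℝ ℝ) (hφ.continuous_partialD i)).comp
      continuous_fst
  · exact ((continuous_pairing (EuclideanSpace.proj (𝕜 := ℝ) i) hφ.continuous).comp
      continuous_snd).neg

/-- `W^{1,∞}(T²)` is a Banach space, so that Bochner integrals in it make sense. -/
instance : CompleteSpace W1Inf := isClosed_W1Inf.completeSpace_coe

/-- The semigroup `e^{-τ Δ²}` on real functions, for `τ > 0`: the Fourier multiplier
`e^{-τ (2π|k|)⁴}`, `k ∈ ℤ²`.  (The series is real, as `f` is.) -/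
def semigroup (τ : ℝ) (f : T2 → ℝ) (x : T2) : ℝ :=
  (∑' k : Fin 2 → ℤ,
    (Real.exp (-τ * (2 * Real.pi) ^ 4 * ((k 0 : ℝ) ^ 2 + (k 1 : ℝ) ^ 2) ^ 2) : ℂ)
      * UnitAddTorus.mFourierCoeff (fun y => (f y : ℂ)) k * UnitAddTorus.mFourier k x).re

/-- `∇ · e^{-τ Δ²} G` for a vector field `G` on the torus and `τ > 0`. -/
def divSemigroup (τ : ℝ) (G : T2 → E2) (x : T2) : ℝ :=
  ∑ j : Fin 2, partialD j (semigroup τ fun y => G y j) x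

/-- The nonlinearity `F(ξ) = |ξ|^{p-2} ξ`. -/
def flux (p : ℝ) (ξ : E2) : E2 := ‖ξ‖ ^ (p - 2) • ξ

/-- `u` is a mild solution on `(0,T]` of `∂ₜu + Δ²u = -∇·(|∇u|^{p-2}∇u)` with initial data `u₀`:
`u ∈ C((0,T]; W^{1,∞})` and, for all `0 < t ≤ T`,
`u(t) = e^{-tΔ²} u₀ - ∫₀ᵗ ∇·e^{-(t-s)Δ²} F(∇u(s)) ds`
in `W^{1,∞}`, where the integral is a (convergent) Bochner integral in `W^{1,∞}`.
Here `a` is `e^{-tΔ²} u₀` and `N s` is `∇·e^{-(t-s)Δ²} F(∇u(s))`, as elements of `W^{1,∞}`. -/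
def IsMildSolution (p T : ℝ) (u₀ : W1Inf) (u : ℝ → W1Inf) : Prop :=
  ContinuousOn u (Ioc 0 T) ∧
  ∀ t ∈ Ioc 0 T, ∃ (a : W1Inf) (N : ℝ → W1Inf),
    fn a =ᵐ[vol] semigroup t (fn u₀) ∧
    (∀ s ∈ Ioo 0 t, fn (N s) =ᵐ[vol] divSemigroup (t - s) fun x => flux p (grad (u s) x)) ∧
    IntervalIntegrable N volume 0 t ∧
    u t = a - ∫ s in (0 : ℝ)..t, N s

/-- `u` is bounded on `(0,T]` with values in `W^{1,∞}`. -/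
def BoundedNearZero (T : ℝ) (u : ℝ → W1Inf) : Prop :=
  ∃ B : ℝ, ∀ t ∈ Ioc 0 T, ‖u t‖ ≤ B

/-- `w ∈ C¹(T²)`: the weak gradient of `w` has a continuous representative. -/
def IsC1 (w : W1Inf) : Prop := ∃ g : C(T2, E2), grad w =ᵐ[vol] g

end ThinFilm

end

noncomputable section
namespace ThinFilm
open UnitAddTorus ComplexConjugate

/-! The mild equation is a Volterra equation `u = a - volterra K u` with a weakly singular kernel,
solved by contraction. On the plane, `∂^α e^{-τΔ²}` is convolution with a Schwartz kernel rescaled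
to length `τ^{1/4}`; averaging translates on the torus against this kernel gives an operator on
`L^∞` of norm at most `C τ^{-|α|/4}` (`norm_op_le`). The map `G ↦ ∇·e^{-τΔ²}G` into `W^{1,∞}` spends
at most two derivatives, so for `τ ≤ 1` it has norm at most `C τ^{-1/2}` (`exists_norm_divHeat_le`),
which is integrable at zero. The flux is Lipschitz with constant `2R^{p-2}` on the ball of radius
`R` (`norm_flux_sub_le`).

Hence the Volterra term contracts with factor `2 L(R) T^{1/2}` on a ball of bounded continuous
functions on `(0,T]` (`exists_volterra`). Uniqueness among bounded solutions comes from the same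
estimate on successive short intervals (`eqOn_of_volterra`).

At time zero the Volterra term is `O(t^{1/2})`, so only the free evolution matters. In `L^∞` it
converges because `Δ²e^{-sΔ²}u₀`, with one derivative left on `u₀`, is `O(s^{-3/4})`
(`tendsto_op_nil_fn`). For `C¹` data the kernels also act as an approximate identity on the gradient
(`tendsto_heat_of_isC1`).

The bookkeeping is done on Fourier coefficients: they determine a bounded function (`ext_coef`), and
weak gradients are the multipliers `2πi k_j` (`isWeakGradient_iff`). This gives the operator
identities and, with absolutely convergent series, identifies these operators with the series in the
definition of a mild solution (`isMildSolution_iff`). -/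

/-! ### Characters and Fourier coefficients on the torus. -/

theorem mFourier_add_apply (k : Fin 2 → ℤ) (x y : T2) :
    mFourier k (x + y) = mFourier k x * mFourier k y := by
  simp [mFourier, fourier_apply, smul_add, AddCircle.toCircle_add]
  ring

theorem mFourier_proj (k : Fin 2 → ℤ) (y : Fin 2 → ℝ) :
    mFourier k (proj y) = Complex.exp (2 * Real.pi * Complex.I * (k 0 * y 0 + k 1 * y 1)) := by
  simp only [mFourier, proj, ContinuousMap.coe_mk, Fin.prod_univ_two, fourier_coe_apply,
    ← Complex.exp_add]
  congr 1
  simp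
  ring

theorem mFourier_single_coe (k : Fin 2 → ℤ) (i : Fin 2) (h : ℝ) :
    mFourier k (Pi.single i (h : UnitAddCircle)) =
      Complex.exp (2 * Real.pi * Complex.I * k i * h) := by
  have : (Pi.single i (h : UnitAddCircle) : T2) = proj (Pi.single i h) := by
    funext j
    by_cases hj : j = i
    · subst hj; simp [proj]
    · simp [proj, hj]
  rw [this, mFourier_proj]
  congr 1
  fin_cases i <;> simp <;> ring

theorem norm_mFourier_apply (k : Fin 2 → ℤ) (x : T2) : ‖mFourier k x‖ = 1 := by
  simp only [mFourier, fourier_apply, ContinuousMap.coe_mk, norm_prod, Circle.norm_coe,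
    Finset.prod_const_one]

theorem hasDerivAt_mFourier_single (k : Fin 2 → ℤ) (i : Fin 2) (x : T2) :
    HasDerivAt (fun h : ℝ => mFourier k (x + Pi.single i (h : UnitAddCircle)))
      (2 * Real.pi * Complex.I * k i * mFourier k x) 0 := by
  have e : (fun h : ℝ => mFourier k (x + Pi.single i (h : UnitAddCircle)))
      = fun h : ℝ => mFourier k x * Complex.exp (2 * Real.pi * Complex.I * k i * h) := by
    funext h
    rw [mFourier_add_apply, mFourier_single_coe]
  rw [e]
  have h1 : HasDerivAt (fun h : ℝ => (2 * Real.pi * Complex.I * k i * h : ℂ))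
      (2 * Real.pi * Complex.I * k i) 0 := by
    simpa using (Complex.ofRealCLM.hasDerivAt (x := (0 : ℝ))).const_mul
      (2 * Real.pi * Complex.I * k i : ℂ)
  have h2 := (h1.cexp).const_mul (mFourier k x)
  refine h2.congr_deriv ?_
  simp
  ring

/-- Fourier coefficient of a complex function on the torus, as an integral against `vol`. -/
def fc (f : T2 → ℂ) (k : Fin 2 → ℤ) : ℂ := ∫ x, mFourier (-k) x * f x ∂vol

theorem mFourierCoeff_eq_fc (f : T2 → ℂ) (k : Fin 2 → ℤ) : mFourierCoeff f k = fc f k := rfl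

theorem fc_congr {f g : T2 → ℂ} (h : f =ᵐ[vol] g) (k : Fin 2 → ℤ) : fc f k = fc g k := by
  refine integral_congr_ae ?_
  filter_upwards [h] with x hx
  rw [hx]

theorem ae_eq_of_fc_eq {f g : T2 → ℂ} (hf : MemLp f 2 vol) (hg : MemLp g 2 vol)
    (h : ∀ k, fc f k = fc g k) : f =ᵐ[vol] g := by
  have key : hf.toLp f = hg.toLp g := by
    apply (mFourierBasis (d := Fin 2)).repr.injective
    ext k
    calc mFourierBasis.repr (hf.toLp f) k = fc (hf.toLp f) k := mFourierBasis_repr _ k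
      _ = fc f k := fc_congr hf.coeFn_toLp k
      _ = fc g k := h k
      _ = fc (hg.toLp g) k := (fc_congr hg.coeFn_toLp k).symm
      _ = mFourierBasis.repr (hg.toLp g) k := (mFourierBasis_repr _ k).symm
  exact (hf.coeFn_toLp.symm.trans (by rw [key])).trans hg.coeFn_toLp

theorem hasSum_conj_fc_mul {f g : T2 → ℂ} (hf : MemLp f 2 vol) (hg : MemLp g 2 vol) :
    HasSum (fun k => conj (fc f k) * fc g k) (∫ x, conj (f x) * g x ∂vol) := by
  have key : HasSum (fun k => conj (fc (hf.toLp f) k) * fc (hg.toLp g) k)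
      (∫ x, conj (hf.toLp f x) * hg.toLp g x ∂vol) :=
    hasSum_prod_mFourierCoeff (d := Fin 2) (hf.toLp f) (hg.toLp g)
  have e1 : ∀ k, fc (hf.toLp f) k = fc f k := fc_congr hf.coeFn_toLp
  have e2 : ∀ k, fc (hg.toLp g) k = fc g k := fc_congr hg.coeFn_toLp
  simp only [e1, e2] at key
  convert key using 1
  refine integral_congr_ae ?_
  filter_upwards [hf.coeFn_toLp, hg.coeFn_toLp] with x hx hy
  rw [hx, hy]

theorem norm_coe_le (F : Type*) [NormedAddCommGroup F] (f : Lp F ∞ vol) :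
    ∀ᵐ x ∂vol, ‖f x‖ ≤ ‖f‖ := by
  filter_upwards [ae_le_eLpNormEssSup (f := f) (μ := vol)] with x hx
  rw [Lp.norm_def, eLpNorm_exponent_top, ← toReal_enorm]
  exact ENNReal.toReal_mono (by simpa using Lp.eLpNorm_ne_top f) hx

theorem norm_le_of_ae_le {F : Type*} [NormedAddCommGroup F] {f : Lp F ∞ vol} {C : ℝ} (hC : 0 ≤ C)
    (h : ∀ᵐ x ∂vol, ‖f x‖ ≤ C) : ‖f‖ ≤ C := by
  simpa using Lp.norm_le_of_ae_bound (p := ∞) hC h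

theorem memLp_ofReal {f : T2 → ℝ} {q : ℝ≥0∞} (hf : MemLp f q vol) :
    MemLp (fun x => (f x : ℂ)) q vol :=
  Complex.ofRealCLM.comp_memLp' hf

theorem integrable_fc {f : T2 → ℝ} (hf : MemLp f ∞ vol) (k : Fin 2 → ℤ) :
    Integrable (fun x => mFourier k x * (f x : ℂ)) vol := by
  refine ((memLp_ofReal hf).integrable le_top).bdd_mul (c := 1)
    (mFourier k).continuous.aestronglyMeasurable (Eventually.of_forall fun x => ?_)
  rw [norm_mFourier_apply]

/-- The Fourier coefficient as a continuous linear functional on `L^∞`. -/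
def coef (k : Fin 2 → ℤ) : Lp ℝ ∞ vol →L[ℝ] ℂ :=
  LinearMap.mkContinuous
    { toFun := fun f => fc (fun x => (f x : ℂ)) k
      map_add' := fun f g => by
        unfold fc
        rw [← integral_add (integrable_fc (Lp.memLp f) _) (integrable_fc (Lp.memLp g) _)]
        refine integral_congr_ae ?_
        filter_upwards [Lp.coeFn_add f g] with x hx
        simp only [hx, Pi.add_apply, Complex.ofReal_add, mul_add]
      map_smul' := fun c f => by
        unfold fc
        rw [RingHom.id_apply, Complex.real_smul, ← integral_const_mul]
        refine integral_congr_ae ?_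
        filter_upwards [Lp.coeFn_smul c f] with x hx
        simp only [hx, Pi.smul_apply, smul_eq_mul, Complex.ofReal_mul]
        ring } 1 fun f => by
    have hb : ∀ᵐ x ∂vol, ‖mFourier (-k) x * (f x : ℂ)‖ ≤ 1 * ‖f‖ := by
      filter_upwards [norm_coe_le ℝ f] with x hx
      rw [norm_mul, norm_mFourier_apply, Complex.norm_real]
      gcongr
    simpa [fc] using norm_integral_le_of_norm_le_const hb

theorem coef_apply (k : Fin 2 → ℤ) (f : Lp ℝ ∞ vol) : coef k f = fc (fun x => (f x : ℂ)) k := rfl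

theorem memLp_two {f : T2 → ℝ} (hf : MemLp f ∞ vol) : MemLp (fun x => (f x : ℂ)) 2 vol :=
  (memLp_ofReal hf).mono_exponent le_top

theorem coef_toLp {f : T2 → ℝ} (hf : MemLp f ∞ vol) (k : Fin 2 → ℤ) :
    coef k (hf.toLp f) = fc (fun x => (f x : ℂ)) k := by
  rw [coef_apply]
  refine fc_congr ?_ k
  filter_upwards [hf.coeFn_toLp] with x hx
  rw [hx]

/-- On a probability space `L^∞` embeds in `L²`, where the characters are a Hilbert basis.
Identities between operators thereby reduce to identities between symbols. -/
theorem ext_coef {f g : Lp ℝ ∞ vol} (h : ∀ k, coef k f = coef k g) : f = g := by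
  refine Lp.ext ?_
  filter_upwards [ae_eq_of_fc_eq (memLp_two (Lp.memLp f)) (memLp_two (Lp.memLp g)) h] with x hx
  exact_mod_cast hx

/-! ### Weak gradients in terms of Fourier coefficients. -/

instance : vol.IsAddHaarMeasure := by unfold vol; infer_instance

theorem IsSmooth.memLp {φ : T2 → ℝ} (h : IsSmooth φ) : MemLp φ ∞ vol := by
  obtain ⟨C, hC⟩ := isCompact_univ.exists_bound_of_continuousOn h.continuous.continuousOn
  exact memLp_top_of_bound h.continuous.aestronglyMeasurable C
    (Eventually.of_forall fun x => hC x (mem_univ x))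

theorem IsSmooth.memLp_partialD {φ : T2 → ℝ} (h : IsSmooth φ) (i : Fin 2) :
    MemLp (partialD i φ) ∞ vol := by
  obtain ⟨C, hC⟩ := isCompact_univ.exists_bound_of_continuousOn
    (h.continuous_partialD i).continuousOn
  exact memLp_top_of_bound (h.continuous_partialD i).aestronglyMeasurable C
    (Eventually.of_forall fun x => hC x (mem_univ x))

theorem IsSmooth.hasDerivAt {φ : T2 → ℝ} (h : IsSmooth φ) (i : Fin 2) (x : T2) (s : ℝ) :
    HasDerivAt (fun s : ℝ => φ (x + Pi.single i (s : UnitAddCircle)))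
      (partialD i φ (x + Pi.single i (s : UnitAddCircle))) s := by
  obtain ⟨y, rfl⟩ := isOpenQuotientMap_proj.surjective x
  have hs : ∀ t : ℝ, proj y + Pi.single i (t : UnitAddCircle)
      = proj (y + t • Pi.single i 1) := by
    intro t
    funext j
    by_cases hj : j = i
    · subst hj; simp [proj]
    · simp [proj, hj]
  rw [hs, partialD_proj h]
  simp only [hs]
  have hd := ((ContDiff.differentiable h (by simp)) (y + s • Pi.single i 1)).hasFDerivAt
  have hl : HasDerivAt (fun t : ℝ => y + t • (Pi.single i 1 : Fin 2 → ℝ)) (Pi.single i 1) s := by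
    simpa using ((hasDerivAt_id s).smul_const (Pi.single i 1 : Fin 2 → ℝ)).const_add y
  exact hd.comp_hasDerivAt s hl

/-- By invariance of the measure, translating `φ` by `s` in direction `i` multiplies the coefficient
by `exp(2πi k_i s)`; differentiate both sides at `s = 0`, on the left under the integral. This
avoids integration by parts. -/
theorem fc_partialD {φ : T2 → ℝ} (h : IsSmooth φ) (i : Fin 2) (k : Fin 2 → ℤ) :
    fc (fun x => (partialD i φ x : ℂ)) k
      = 2 * Real.pi * Complex.I * k i * fc (fun x => (φ x : ℂ)) k := by
  obtain ⟨C, hC⟩ := isCompact_univ.exists_bound_of_continuousOn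
    (h.continuous_partialD i).continuousOn
  have hadd : ∀ s : ℝ, Continuous fun x : T2 => x + Pi.single i (s : UnitAddCircle) := fun s => by
    fun_prop
  have hφ := h.continuous
  have hφ' := h.continuous_partialD i
  have h1 := (hasDerivAt_integral_of_dominated_loc_of_deriv_le (μ := vol) (𝕜 := ℝ)
    (F := fun (s : ℝ) x => mFourier (-k) x * (φ (x + Pi.single i (s : UnitAddCircle)) : ℂ))
    (F' := fun (s : ℝ) x => mFourier (-k) x *
      (partialD i φ (x + Pi.single i (s : UnitAddCircle)) : ℂ))
    (x₀ := 0) (s := univ) (bound := fun _ => C) univ_mem ?_ ?_ ?_ ?_ ?_ ?_).2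
  · have h2 : ∀ s : ℝ, ∫ x, mFourier (-k) x * (φ (x + Pi.single i (s : UnitAddCircle)) : ℂ) ∂vol
        = Complex.exp (2 * Real.pi * Complex.I * k i * s) * fc (fun x => (φ x : ℂ)) k := by
      intro s
      unfold fc
      rw [← integral_const_mul, ← integral_add_right_eq_self
        (fun x => Complex.exp (2 * Real.pi * Complex.I * k i * s) * (mFourier (-k) x * (φ x : ℂ)))
        (Pi.single i (s : UnitAddCircle))]
      congr 1
      funext x
      rw [mFourier_add_apply, mFourier_single_coe, mul_comm (mFourier (-k) x) (Complex.exp _),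
        ← mul_assoc, ← mul_assoc, ← Complex.exp_add]
      simp
    simp only [h2] at h1
    have h3 : HasDerivAt (fun s : ℝ => Complex.exp (2 * Real.pi * Complex.I * k i * s)
        * fc (fun x => (φ x : ℂ)) k)
        (2 * Real.pi * Complex.I * k i * fc (fun x => (φ x : ℂ)) k) 0 := by
      have h1 : HasDerivAt (fun h : ℝ => (2 * Real.pi * Complex.I * k i * h : ℂ))
          (2 * Real.pi * Complex.I * k i) 0 := by
        simpa using (Complex.ofRealCLM.hasDerivAt (x := (0 : ℝ))).const_mul
          (2 * Real.pi * Complex.I * k i : ℂ)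
      simpa using (h1.cexp).mul_const (fc (fun x => (φ x : ℂ)) k)
    have := h1.unique h3
    simpa [fc] using this
  · refine Eventually.of_forall fun s => Continuous.aestronglyMeasurable ?_
    exact (mFourier (-k)).continuous.mul (Complex.continuous_ofReal.comp (hφ.comp (hadd s)))
  · simpa using integrable_fc h.memLp (-k)
  · refine Continuous.aestronglyMeasurable ?_
    exact (mFourier (-k)).continuous.mul (Complex.continuous_ofReal.comp (hφ'.comp (hadd 0)))
  · refine Eventually.of_forall fun x s _ => ?_
    rw [norm_mul, norm_mFourier_apply, one_mul, Complex.norm_real]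
    exact hC _ (mem_univ _)
  · exact integrable_const _
  · refine Eventually.of_forall fun x s _ => ?_
    exact ((h.hasDerivAt i x s).ofReal_comp).const_mul _

theorem isSmooth_mFourier_re (k : Fin 2 → ℤ) : IsSmooth fun x => (mFourier k x).re := by
  unfold IsSmooth
  simp only [mFourier_proj]
  refine Complex.reCLM.contDiff.comp (ContDiff.cexp (contDiff_const.mul ?_))
  refine ContDiff.add (contDiff_const.mul ?_) (contDiff_const.mul ?_) <;>
    exact Complex.ofRealCLM.contDiff.comp (contDiff_apply _ _ _)

theorem isSmooth_mFourier_im (k : Fin 2 → ℤ) : IsSmooth fun x => (mFourier k x).im := by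
  unfold IsSmooth
  simp only [mFourier_proj]
  refine Complex.imCLM.contDiff.comp (ContDiff.cexp (contDiff_const.mul ?_))
  refine ContDiff.add (contDiff_const.mul ?_) (contDiff_const.mul ?_) <;>
    exact Complex.ofRealCLM.contDiff.comp (contDiff_apply _ _ _)

theorem partialD_mFourier_re (k : Fin 2 → ℤ) (i : Fin 2) (x : T2) :
    partialD i (fun x => (mFourier k x).re) x
      = (2 * Real.pi * Complex.I * k i * mFourier k x).re :=
  ((Complex.reCLM.hasFDerivAt.comp_hasDerivAt _ (hasDerivAt_mFourier_single k i x))).deriv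

theorem partialD_mFourier_im (k : Fin 2 → ℤ) (i : Fin 2) (x : T2) :
    partialD i (fun x => (mFourier k x).im) x
      = (2 * Real.pi * Complex.I * k i * mFourier k x).im :=
  ((Complex.imCLM.hasFDerivAt.comp_hasDerivAt _ (hasDerivAt_mFourier_single k i x))).deriv

/-- The `i`-th component of a bounded vector field. -/
def comp (i : Fin 2) : Lp E2 ∞ vol →L[ℝ] Lp ℝ ∞ vol :=
  (EuclideanSpace.proj (𝕜 := ℝ) i).compLpL ∞ vol

theorem coeFn_comp (i : Fin 2) (g : Lp E2 ∞ vol) : comp i g =ᵐ[vol] fun x => g x i :=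
  ContinuousLinearMap.coeFn_compLpL _ _

/-- A function and a vector field are related by the weak gradient if and only if their Fourier
coefficients are related by the multipliers `2πi k_j`. -/
theorem isWeakGradient_iff (f : Lp ℝ ∞ vol) (g : Lp E2 ∞ vol) :
    IsWeakGradient f g ↔
      ∀ i k, coef k (comp i g) = 2 * Real.pi * Complex.I * k i * coef k f := by
  have hcomp : ∀ (i : Fin 2) (φ : T2 → ℝ),
      ∫ x, g x i * φ x ∂vol = ∫ x, comp i g x * φ x ∂vol := fun i φ => by
    refine integral_congr_ae ?_
    filter_upwards [coeFn_comp i g] with x hx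
    rw [hx]
  have hre : ∀ F : T2 → ℂ, Integrable F vol → ∫ x, (F x).re ∂vol = (∫ x, F x ∂vol).re :=
    fun F hF => integral_re hF
  have him : ∀ F : T2 → ℂ, Integrable F vol → ∫ x, (F x).im ∂vol = (∫ x, F x ∂vol).im :=
    fun F hF => integral_im hF
  constructor
  · intro h i k
    -- Test functions are real, so the character `-k` is tested through its real and imaginary
    -- parts, which are recombined at the end.
    have h1 := h i _ (isSmooth_mFourier_re (-k))
    have h2 := h i _ (isSmooth_mFourier_im (-k))
    simp only [partialD_mFourier_re, partialD_mFourier_im, hcomp] at h1 h2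
    have e1 : (fun x => f x * (2 * Real.pi * Complex.I * (-k) i * mFourier (-k) x).re)
        = fun x => (2 * Real.pi * Complex.I * (-k) i * (mFourier (-k) x * (f x : ℂ))).re := by
      funext x
      rw [← Complex.re_ofReal_mul]; congr 1; ring
    have e2 : (fun x => f x * (2 * Real.pi * Complex.I * (-k) i * mFourier (-k) x).im)
        = fun x => (2 * Real.pi * Complex.I * (-k) i * (mFourier (-k) x * (f x : ℂ))).im := by
      funext x
      rw [← Complex.im_ofReal_mul]; congr 1; ring
    have e3 : (fun x => comp i g x * (mFourier (-k) x).re)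
        = fun x => (mFourier (-k) x * (comp i g x : ℂ)).re := by
      funext x
      rw [← Complex.re_ofReal_mul]; congr 1; ring
    have e4 : (fun x => comp i g x * (mFourier (-k) x).im)
        = fun x => (mFourier (-k) x * (comp i g x : ℂ)).im := by
      funext x
      rw [← Complex.im_ofReal_mul]; congr 1; ring
    have i1 := integrable_fc (Lp.memLp f) (-k)
    have i2 := integrable_fc (Lp.memLp (comp i g)) (-k)
    rw [e1, e3, hre _ (i1.const_mul _), hre _ i2, integral_const_mul] at h1
    rw [e2, e4, him _ (i1.const_mul _), him _ i2, integral_const_mul] at h2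
    have : (2 * Real.pi * Complex.I * (-k) i * coef k f : ℂ) = - coef k (comp i g) :=
      Complex.ext h1 h2
    rw [← neg_eq_iff_eq_neg] at this
    rw [← this]
    simp
  · intro h i φ hφ
    rw [hcomp]
    have hf2 := memLp_two (Lp.memLp f)
    have hg2 := memLp_two (Lp.memLp (comp i g))
    -- Parseval turns both integrals into sums over `k`; the minus sign is the conjugation of `2πi
    -- k_i`.
    have hs1 := hasSum_conj_fc_mul hf2 (memLp_two (hφ.memLp_partialD i))
    have hs2 := hasSum_conj_fc_mul hg2 (memLp_two hφ.memLp)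
    have : (fun k => conj (fc (fun x => (f x : ℂ)) k) * fc (fun x => (partialD i φ x : ℂ)) k)
        = fun k => -(conj (fc (fun x => (comp i g x : ℂ)) k) * fc (fun x => (φ x : ℂ)) k) := by
      funext k
      rw [fc_partialD hφ, ← coef_apply k (comp i g), h i k, coef_apply]
      simp [Complex.conj_ofNat]
      ring
    rw [this] at hs1
    have key := hs1.unique hs2.neg
    simp only [Complex.conj_ofReal, ← Complex.ofReal_mul, integral_complex_ofReal] at key
    exact_mod_cast key

/-! ### Convolution of functions on the torus with kernels on the plane. -/

/-- The covering map `ℝ² → T²` on Euclidean space. -/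
def pr (z : E2) : T2 := proj z.ofLp

theorem continuous_pr : Continuous pr := by
  unfold pr proj
  refine continuous_pi fun i => ?_
  exact (AddCircle.continuous_mk' 1).comp (by fun_prop)

/-- Averaging of the translates of a function on the torus against a kernel on the plane. -/
def conv (κ : E2 → ℝ) (f : T2 → ℝ) (x : T2) : ℝ := ∫ z, κ z * f (x - pr z)

/-- The Fourier transform of a kernel on the plane at the integer point `k`. -/
def ft (κ : E2 → ℝ) (k : Fin 2 → ℤ) : ℂ := ∫ z, mFourier (-k) (pr z) * (κ z : ℂ)

theorem stronglyMeasurable_conv {κ : E2 → ℝ} (hc : Continuous κ) {f : T2 → ℝ}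
    (hf : StronglyMeasurable f) : StronglyMeasurable (conv κ f) := by
  have : StronglyMeasurable fun q : T2 × E2 => κ q.2 * f (q.1 - pr q.2) := by
    refine (hc.comp continuous_snd).stronglyMeasurable.mul (hf.comp_measurable ?_)
    exact (continuous_fst.sub (continuous_pr.comp continuous_snd)).measurable
  exact this.integral_prod_right

theorem integrable_conv {κ : E2 → ℝ} (hi : Integrable κ) {f : T2 → ℝ}
    (hf : StronglyMeasurable f) {B : ℝ} (hB : ∀ x, ‖f x‖ ≤ B) (x : T2) :
    Integrable fun z => κ z * f (x - pr z) := by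
  refine hi.mul_bdd (c := B) ?_ (Eventually.of_forall fun z => hB _)
  exact (hf.comp_measurable
    (continuous_const.sub continuous_pr).measurable).aestronglyMeasurable

theorem norm_conv_le {κ : E2 → ℝ} (hi : Integrable κ) {f : T2 → ℝ}
    {B : ℝ} (hB : ∀ x, ‖f x‖ ≤ B) (x : T2) : ‖conv κ f x‖ ≤ (∫ z, ‖κ z‖) * B := by
  unfold conv
  rw [← integral_mul_const]
  refine norm_integral_le_of_norm_le (hi.norm.mul_const B) (Eventually.of_forall fun z => ?_)
  rw [norm_mul]
  gcongr
  exact hB _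

/-- Fubini, followed by the substitution `x ↦ x + pr z` in the inner integral, under which the
character factors. -/
theorem fc_conv {κ : E2 → ℝ} (hc : Continuous κ) (hi : Integrable κ) {f : T2 → ℝ}
    (hf : StronglyMeasurable f) {B : ℝ} (hB : ∀ x, ‖f x‖ ≤ B) (k : Fin 2 → ℤ) :
    fc (fun x => (conv κ f x : ℂ)) k = ft κ k * fc (fun x => (f x : ℂ)) k := by
  have hm : StronglyMeasurable fun q : T2 × E2 =>
      mFourier (-k) q.1 * ((κ q.2 : ℂ) * (f (q.1 - pr q.2) : ℂ)) := by
    refine ((mFourier (-k)).continuous.comp continuous_fst).stronglyMeasurable.mul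
      (StronglyMeasurable.mul ?_ ?_)
    · exact (Complex.continuous_ofReal.comp (hc.comp continuous_snd)).stronglyMeasurable
    · exact Complex.continuous_ofReal.comp_stronglyMeasurable (hf.comp_measurable
        (continuous_fst.sub (continuous_pr.comp continuous_snd)).measurable)
  have hint : Integrable (fun q : T2 × E2 =>
      mFourier (-k) q.1 * ((κ q.2 : ℂ) * (f (q.1 - pr q.2) : ℂ))) (vol.prod volume) := by
    refine Integrable.mono' (g := fun q => ‖κ q.2‖ * B) ?_ hm.aestronglyMeasurable
      (Eventually.of_forall fun q => ?_)
    · exact (hi.norm.mul_const B).comp_snd vol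
    · rw [norm_mul, norm_mul, norm_mFourier_apply, one_mul, Complex.norm_real, Complex.norm_real]
      gcongr
      exact hB _
  calc fc (fun x => (conv κ f x : ℂ)) k
      = ∫ x, ∫ z, mFourier (-k) x * ((κ z : ℂ) * (f (x - pr z) : ℂ)) ∂volume ∂vol := by
        unfold fc conv
        congr 1
        funext x
        rw [integral_const_mul]
        simp only [← Complex.ofReal_mul, integral_complex_ofReal]
    _ = ∫ z, ∫ x, mFourier (-k) x * ((κ z : ℂ) * (f (x - pr z) : ℂ)) ∂vol :=
        integral_integral_swap hint
    _ = ∫ z, (mFourier (-k) (pr z) * (κ z : ℂ)) * fc (fun x => (f x : ℂ)) k := by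
        congr 1
        funext z
        rw [← integral_add_right_eq_self _ (pr z)]
        unfold fc
        rw [← integral_const_mul]
        congr 1
        funext x
        rw [mFourier_add_apply, add_sub_cancel_right]
        ring
    _ = ft κ k * fc (fun x => (f x : ℂ)) k := by rw [integral_mul_const]; rfl

/-- Truncating on the null set where the essential bound fails gives a bound at every point, as the
pointwise estimates for `conv` require. -/
theorem exists_bounded_rep (f : Lp ℝ ∞ vol) :
    ∃ f' : T2 → ℝ, StronglyMeasurable f' ∧ (∀ x, ‖f' x‖ ≤ ‖f‖) ∧ f =ᵐ[vol] f' := by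
  have hs : MeasurableSet {x | ‖f x‖ ≤ ‖f‖} :=
    measurableSet_le (Lp.stronglyMeasurable f).norm.measurable measurable_const
  refine ⟨{x | ‖f x‖ ≤ ‖f‖}.indicator f, (Lp.stronglyMeasurable f).indicator hs, fun x => ?_, ?_⟩
  · by_cases hx : x ∈ {x | ‖f x‖ ≤ ‖f‖}
    · rw [indicator_of_mem hx]; exact hx
    · rw [indicator_of_notMem hx]; simp
  · filter_upwards [norm_coe_le ℝ f] with x hx
    rw [indicator_of_mem]
    exact hx

theorem memLp_conv {κ : E2 → ℝ} (hc : Continuous κ) (hi : Integrable κ) {f : T2 → ℝ}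
    (hf : StronglyMeasurable f) {B : ℝ} (hB : ∀ x, ‖f x‖ ≤ B) : MemLp (conv κ f) ∞ vol :=
  memLp_top_of_bound (stronglyMeasurable_conv hc hf).aestronglyMeasurable _
    (Eventually.of_forall fun x => norm_conv_le hi hB x)

/-- `A` acts on Fourier coefficients as multiplication by `m`. -/
def IsMultiplier (A : Lp ℝ ∞ vol →L[ℝ] Lp ℝ ∞ vol) (m : (Fin 2 → ℤ) → ℂ) : Prop :=
  ∀ f k, coef k (A f) = m k * coef k f

theorem IsMultiplier.unique {A A' : Lp ℝ ∞ vol →L[ℝ] Lp ℝ ∞ vol} {m : (Fin 2 → ℤ) → ℂ}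
    (h : IsMultiplier A m) (h' : IsMultiplier A' m) : A = A' :=
  ContinuousLinearMap.ext fun f => ext_coef fun k => (h f k).trans (h' f k).symm

/-- The convolution is formed from a chosen representative of each class. Linearity of the choice
needs no pointwise argument: it is read off the coefficients through `ext_coef`. -/
theorem exists_isMultiplier_ft {κ : E2 → ℝ} (hc : Continuous κ) (hi : Integrable κ) :
    ∃ A : Lp ℝ ∞ vol →L[ℝ] Lp ℝ ∞ vol, ‖A‖ ≤ ∫ z, ‖κ z‖ ∧ IsMultiplier A (ft κ) := by
  have hex : ∀ f : Lp ℝ ∞ vol, ∃ h : Lp ℝ ∞ vol,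
      ‖h‖ ≤ (∫ z, ‖κ z‖) * ‖f‖ ∧ ∀ k, coef k h = ft κ k * coef k f := by
    intro f
    obtain ⟨f', hm, hB, hff'⟩ := exists_bounded_rep f
    have hL := memLp_conv hc hi hm hB
    refine ⟨hL.toLp _, ?_, fun k => ?_⟩
    · refine norm_le_of_ae_le (by positivity) ?_
      filter_upwards [hL.coeFn_toLp] with x hx
      rw [hx]
      exact norm_conv_le hi hB x
    · rw [coef_toLp, fc_conv hc hi hm hB, coef_apply]
      congr 1
      refine fc_congr ?_ k
      filter_upwards [hff'] with x hx
      rw [hx]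
  choose H hH hc' using hex
  refine ⟨LinearMap.mkContinuous
    { toFun := H
      map_add' := fun f g => ext_coef fun k => by
        rw [map_add, hc', hc', hc', map_add, mul_add]
      map_smul' := fun c f => ext_coef fun k => by
        rw [RingHom.id_apply, map_smul, hc', hc', map_smul, mul_smul_comm] } _ hH, ?_, hc'⟩
  exact LinearMap.mkContinuous_norm_le _ (by positivity) _

/-- If `f` has a continuous representative `g`, then averaging `f` against a kernel displaces it
by at most the average displacement of `g` under translations. -/
theorem norm_multiplier_sub_le {κ : E2 → ℝ} (hc : Continuous κ) (hi : Integrable κ)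
    (h1 : ∫ z, κ z = 1) {A : Lp ℝ ∞ vol →L[ℝ] Lp ℝ ∞ vol} (hA : IsMultiplier A (ft κ))
    {f : Lp ℝ ∞ vol} {g : T2 → ℝ} (hg : Continuous g) (hfg : f =ᵐ[vol] g) {η : E2 → ℝ}
    (hη : ∀ x z, ‖g (x - pr z) - g x‖ ≤ η z) (hηi : Integrable fun z => ‖κ z‖ * η z) :
    ‖A f - f‖ ≤ ∫ z, ‖κ z‖ * η z := by
  obtain ⟨B, hB⟩ := isCompact_univ.exists_bound_of_continuousOn hg.continuousOn
  replace hB : ∀ x, ‖g x‖ ≤ B := fun x => hB x (mem_univ x)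
  have hL := memLp_conv hc hi hg.stronglyMeasurable hB
  have hAf : A f = hL.toLp _ := ext_coef fun k => by
    rw [hA, coef_toLp, fc_conv hc hi hg.stronglyMeasurable hB, coef_apply]
    congr 1
    refine fc_congr ?_ k
    filter_upwards [hfg] with x hx
    rw [hx]
  have hη0 : ∀ z, 0 ≤ η z := fun z => (norm_nonneg _).trans (hη 0 z)
  refine norm_le_of_ae_le (integral_nonneg fun z => mul_nonneg (norm_nonneg _) (hη0 z)) ?_
  rw [hAf]
  filter_upwards [Lp.coeFn_sub (hL.toLp _) f, hL.coeFn_toLp, hfg] with x h2 h3 h4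
  rw [h2, Pi.sub_apply, h3, h4]
  have : conv κ g x - g x = ∫ z, κ z * (g (x - pr z) - g x) := by
    unfold conv
    simp only [mul_sub]
    rw [integral_sub (integrable_conv hi hg.stronglyMeasurable hB x) (hi.mul_const _),
      integral_mul_const, h1, one_mul]
  rw [this]
  refine norm_integral_le_of_norm_le hηi (Eventually.of_forall fun z => ?_)
  rw [norm_mul]
  exact mul_le_mul_of_nonneg_left (hη x z) (norm_nonneg _)

/-! ### Schwartz kernels of the operators `∂^α e^{-τΔ²}` on the plane. -/

section Kernels
open SchwartzMap FourierTransform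

theorem exists_one_add_pow_mul_exp_le (m : ℕ) :
    ∃ C : ℝ, ∀ r : ℝ, 0 ≤ r → (1 + r) ^ m * Real.exp (-((2 * Real.pi) ^ 4 * (r ^ 2) ^ 2)) ≤ C := by
  refine ⟨m.factorial * Real.exp 2, fun r hr => ?_⟩
  have hpi : (1 : ℝ) ≤ (2 * Real.pi) ^ 4 := by
    apply one_le_pow₀
    linarith [Real.pi_gt_three]
  have h1 : 1 + r ≤ 2 + (r ^ 2) ^ 2 := by
    nlinarith [sq_nonneg (r ^ 2 - 1), sq_nonneg (r - 1), sq_nonneg r]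
  have h2 : (1 + r) ^ m ≤ m.factorial * Real.exp (2 + (r ^ 2) ^ 2) := by
    have := Real.pow_div_factorial_le_exp (2 + (r ^ 2) ^ 2) (by positivity) m
    rw [div_le_iff₀ (by positivity)] at this
    calc (1 + r) ^ m ≤ (2 + (r ^ 2) ^ 2) ^ m := by gcongr
      _ ≤ _ := by linarith
  calc (1 + r) ^ m * Real.exp (-((2 * Real.pi) ^ 4 * (r ^ 2) ^ 2))
      ≤ (m.factorial * Real.exp (2 + (r ^ 2) ^ 2)) * Real.exp (-(r ^ 2) ^ 2) := by
        gcongr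
        nlinarith [sq_nonneg (r ^ 2)]
    _ = m.factorial * Real.exp 2 := by
        rw [mul_assoc, ← Real.exp_add]
        congr 2
        ring

/-- The symbol of `e^{-Δ²}` on the plane, as a Schwartz function. -/
def baseSymbol : 𝓢(E2, ℝ) where
  toFun := Real.exp ∘ fun ξ => -((2 * Real.pi) ^ 4 * (‖ξ‖ ^ 2) ^ 2)
  smooth' := by
    refine Real.contDiff_exp.comp (ContDiff.neg (contDiff_const.mul ((contDiff_norm_sq ℝ).pow 2)))
  decay' := by
    intro k n
    have hf : Function.HasTemperateGrowth fun ξ : E2 => -((2 * Real.pi) ^ 4 * (‖ξ‖ ^ 2) ^ 2) :=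
      ((Function.HasTemperateGrowth.const _).mul
        ((Function.hasTemperateGrowth_norm_sq (H := E2)).pow 2)).neg
    obtain ⟨k₁, C₁, hC₁, h₁⟩ := hf.norm_iteratedFDeriv_le_uniform n
    obtain ⟨C, hC⟩ := exists_one_add_pow_mul_exp_le (k + k₁ * n)
    refine ⟨n.factorial * (1 + C₁) ^ n * C, fun x => ?_⟩
    -- Faà di Bruno bound: every derivative of `exp` is `exp` again, and the exponent grows
    -- temperately, so the result is a polynomial times the symbol itself. Using `1 + C₁` makes the
    -- base `D` at least one, so that its powers dominate it.
    have key := norm_iteratedFDeriv_comp_le (𝕜 := ℝ) (g := Real.exp) (n := n) (N := ∞)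
      Real.contDiff_exp hf.1 (mod_cast le_top) x
      (C := Real.exp (-((2 * Real.pi) ^ 4 * (‖x‖ ^ 2) ^ 2)))
      (D := (1 + C₁) * (1 + ‖x‖) ^ k₁) (fun i _ => by
        rw [norm_iteratedFDeriv_eq_norm_iteratedDeriv, iteratedDeriv_eq_iterate,
          Real.iter_deriv_exp, Real.norm_of_nonneg (Real.exp_nonneg _)]) (fun i hi hin => by
        calc _ ≤ C₁ * (1 + ‖x‖) ^ k₁ := h₁ i hin x
          _ ≤ (1 + C₁) * (1 + ‖x‖) ^ k₁ := by gcongr; simp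
          _ ≤ _ := by
            apply le_self_pow₀
              (one_le_mul_of_one_le_of_one_le (by simp [hC₁]) (by simp [one_le_pow₀]))
            omega)
    calc ‖x‖ ^ k * ‖iteratedFDeriv ℝ n _ x‖
        ≤ (1 + ‖x‖) ^ k * (n.factorial * Real.exp (-((2 * Real.pi) ^ 4 * (‖x‖ ^ 2) ^ 2))
          * ((1 + C₁) * (1 + ‖x‖) ^ k₁) ^ n) := by
          gcongr
          · linarith
      _ = n.factorial * (1 + C₁) ^ n * ((1 + ‖x‖) ^ (k + k₁ * n)
          * Real.exp (-((2 * Real.pi) ^ 4 * (‖x‖ ^ 2) ^ 2))) := by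
          rw [mul_pow (1 + C₁), ← pow_mul (1 + ‖x‖), pow_add]; ring
      _ ≤ _ := by gcongr; exact hC _ (norm_nonneg x)

/-- The symbol of `∂^α e^{-Δ²}` on the plane. -/
def symbol : List (Fin 2) → 𝓢(E2, ℂ)
  | [] => baseSymbol.postcompCLM Complex.ofRealCLM
  | j :: α => smulLeftCLM ℂ (fun ξ : E2 => (2 * Real.pi * Complex.I * (ξ j : ℂ) : ℂ)) (symbol α)

theorem hasTemperateGrowth_coord (j : Fin 2) : Function.HasTemperateGrowth
    fun ξ : E2 => (2 * Real.pi * Complex.I * (ξ j : ℂ) : ℂ) :=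
  (Function.HasTemperateGrowth.const _).mul
    (Complex.ofRealCLM.comp (EuclideanSpace.proj (𝕜 := ℝ) j)).hasTemperateGrowth

theorem symbol_apply (α : List (Fin 2)) (ξ : E2) :
    symbol α ξ = (α.map fun j => (2 * Real.pi * Complex.I * (ξ j : ℂ) : ℂ)).prod
      * (Real.exp (-((2 * Real.pi) ^ 4 * (‖ξ‖ ^ 2) ^ 2)) : ℂ) := by
  induction α with
  | nil =>
    simp only [symbol, List.map_nil, List.prod_nil, one_mul, postcompCLM_apply]
    rfl
  | cons j α ih =>
    rw [symbol, smulLeftCLM_apply_apply (hasTemperateGrowth_coord j), ih]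
    simp only [List.map_cons, List.prod_cons, smul_eq_mul, mul_assoc]

/-- Each factor `2πi ξ_j` changes sign under conjugation, and the exponential is real and even. This
symmetry makes the convolution kernel real. -/
theorem conj_symbol (α : List (Fin 2)) (ξ : E2) : conj (symbol α ξ) = symbol α (-ξ) := by
  simp only [symbol_apply, map_mul, Complex.conj_ofReal, norm_neg]
  congr 1
  induction α with
  | nil => simp
  | cons j α ih =>
    simp only [List.map_cons, List.prod_cons, map_mul, ih]
    congr 1
    simp [Complex.conj_ofNat]

/-- The convolution kernel of `∂^α e^{-Δ²}` on the plane. -/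
def kernel (α : List (Fin 2)) : 𝓢(E2, ℝ) := (𝓕⁻ (symbol α)).postcompCLM Complex.reCLM

theorem ofReal_kernel (α : List (Fin 2)) (z : E2) : (kernel α z : ℂ) = 𝓕⁻ (symbol α) z := by
  have : conj (𝓕⁻ (symbol α) z) = 𝓕⁻ (symbol α) z := by
    rw [SchwartzMap.fourierInv_coe, Real.fourierInv_eq', ← integral_conj]
    rw [← integral_neg_eq_self]
    congr 1
    funext ξ
    simp only [smul_eq_mul, map_mul, conj_symbol, neg_neg, ← Complex.exp_conj, Complex.conj_I,
      Complex.conj_ofReal, inner_neg_left]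
    simp
  rw [kernel, postcompCLM_apply]
  exact Complex.conj_eq_iff_re.1 this

theorem integral_exp_mul_kernel (α : List (Fin 2)) (w : E2) :
    ∫ z : E2, Complex.exp ((-2 * Real.pi * inner ℝ z w : ℝ) * Complex.I) * (kernel α z : ℂ)
      = symbol α w := by
  have h : 𝓕 (𝓕⁻ (symbol α)) w = symbol α w := by rw [fourier_fourierInv_eq]
  rw [← h, SchwartzMap.fourier_coe, Real.fourier_eq']
  simp only [ofReal_kernel, smul_eq_mul]

/-- The kernel of `∂^α e^{-r⁴Δ²}` on the plane. -/
def dker (α : List (Fin 2)) (r : ℝ) (z : E2) : ℝ := (r ^ (α.length + 2))⁻¹ * kernel α (r⁻¹ • z)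

theorem continuous_dker (α : List (Fin 2)) (r : ℝ) : Continuous (dker α r) :=
  continuous_const.mul ((kernel α).continuous.comp (continuous_const_smul _))

theorem integrable_dker (α : List (Fin 2)) {r : ℝ} (hr : 0 < r) : Integrable (dker α r) :=
  (((kernel α).integrable (μ := volume)).comp_smul (inv_ne_zero hr.ne')).const_mul _

/-- Of the power `|α| + 2` in `dker`, the 2 is the Jacobian in the plane. The remaining `r^{-|α|}`,
at `r = τ^{1/4}`, is the source of all smoothing rates. -/
theorem integral_norm_dker (α : List (Fin 2)) {r : ℝ} (hr : 0 < r) :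
    ∫ z, ‖dker α r z‖ = (r ^ α.length)⁻¹ * ∫ z, ‖kernel α z‖ := by
  simp only [dker, norm_mul]
  rw [integral_const_mul, Measure.integral_comp_inv_smul_of_nonneg volume
    (fun z => ‖kernel α z‖) hr.le]
  have : Module.finrank ℝ E2 = 2 := by simp
  rw [this, Real.norm_of_nonneg (by positivity), smul_eq_mul, pow_add]
  field_simp

/-- An integer point of the plane. -/
def intPt (k : Fin 2 → ℤ) : E2 := WithLp.toLp 2 fun i => (k i : ℝ)

/-- The symbol of `∂^α e^{-τΔ²}` on the torus. -/
def sym (α : List (Fin 2)) (τ : ℝ) (k : Fin 2 → ℤ) : ℂ :=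
  (α.map fun j => (2 * Real.pi * Complex.I * k j : ℂ)).prod
    * (Real.exp (-τ * (2 * Real.pi) ^ 4 * ((k 0 : ℝ) ^ 2 + (k 1 : ℝ) ^ 2) ^ 2) : ℂ)

theorem sym_eq_symbol (α : List (Fin 2)) {r : ℝ} (hr : 0 < r) (k : Fin 2 → ℤ) :
    sym α (r ^ 4) k = ((r ^ α.length)⁻¹ : ℝ) * symbol α (r • intPt k) := by
  have hnorm : ‖r • intPt k‖ ^ 2 = r ^ 2 * ((k 0 : ℝ) ^ 2 + (k 1 : ℝ) ^ 2) := by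
    rw [norm_smul, mul_pow, EuclideanSpace.norm_sq_eq]
    simp [intPt, Fin.sum_univ_two]
  have hprod : (α.map fun j => (2 * Real.pi * Complex.I * ((r • intPt k) j : ℂ) : ℂ)).prod
      = (r : ℂ) ^ α.length * (α.map fun j => (2 * Real.pi * Complex.I * k j : ℂ)).prod := by
    induction α with
    | nil => simp
    | cons j α ih =>
      rw [List.map_cons, List.prod_cons, ih, List.map_cons, List.prod_cons, List.length_cons,
        pow_succ]
      simp only [intPt, PiLp.smul_apply, smul_eq_mul, Complex.ofReal_mul, Complex.ofReal_intCast]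
      ring
  have hr' : (r : ℂ) ≠ 0 := by exact_mod_cast hr.ne'
  have e : (2 * Real.pi) ^ 4 * (r ^ 2 * ((k 0 : ℝ) ^ 2 + (k 1 : ℝ) ^ 2)) ^ 2
      = r ^ 4 * (2 * Real.pi) ^ 4 * ((k 0 : ℝ) ^ 2 + (k 1 : ℝ) ^ 2) ^ 2 := by ring
  rw [symbol_apply, sym, hnorm, hprod, e, neg_mul, neg_mul]
  push_cast
  field_simp

/-- Pulled back to the plane, the character `k` is the exponential of frequency `k`, so the torus
multiplier is the planar symbol sampled at integer points; the dilation moves the sample to `r k`.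
-/
theorem ft_dker (α : List (Fin 2)) {r : ℝ} (hr : 0 < r) (k : Fin 2 → ℤ) :
    ft (dker α r) k = sym α (r ^ 4) k := by
  have h1 : ft (dker α r) k = ((r ^ (α.length + 2))⁻¹ : ℝ) * ∫ z : E2,
      Complex.exp ((-2 * Real.pi * inner ℝ (r⁻¹ • z) (r • intPt k) : ℝ) * Complex.I)
        * (kernel α (r⁻¹ • z) : ℂ) := by
    rw [← integral_const_mul]
    unfold ft
    congr 1
    funext z
    rw [pr, mFourier_proj, dker]
    have : inner ℝ (r⁻¹ • z) (r • intPt k) = k 0 * z 0 + k 1 * z 1 := by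
      rw [inner_smul_left, inner_smul_right, ← mul_assoc]
      simp [hr.ne', intPt, PiLp.inner_apply, Fin.sum_univ_two]
    rw [this]
    push_cast
    rw [mul_left_comm]
    congr 3
    simp
    ring
  rw [h1, Measure.integral_comp_inv_smul_of_nonneg volume (fun y : E2 =>
    Complex.exp ((-2 * Real.pi * inner ℝ y (r • intPt k) : ℝ) * Complex.I)
        * (kernel α y : ℂ)) hr.le, integral_exp_mul_kernel, sym_eq_symbol α hr]
  have hfin : Module.finrank ℝ E2 = 2 := by simp
  have hr' : (r : ℂ) ≠ 0 := by exact_mod_cast hr.ne'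
  rw [hfin, Complex.real_smul]
  push_cast
  rw [pow_add]
  field_simp

/-- Dominated convergence: for `r` between `r₀/2` and `2r₀`, Schwartz decay bounds all kernels by a
common multiple of `(1 + |z|)^{-3}`, integrable in dimension two. -/
theorem tendsto_integral_norm_dker_sub (α : List (Fin 2)) {r₀ : ℝ} (hr₀ : 0 < r₀) :
    Tendsto (fun r => ∫ z, ‖dker α r z - dker α r₀ z‖) (𝓝 r₀) (𝓝 0) := by
  set n := α.length + 2 with hn
  obtain ⟨C, hC⟩ : ∃ C, ∀ y : E2, (1 + ‖y‖) ^ 3 * ‖kernel α y‖ ≤ C := by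
    refine ⟨2 ^ 3 * ((Finset.Iic (3, 0)).sup fun m => SchwartzMap.seminorm ℝ m.1 m.2) (kernel α),
      fun y => ?_⟩
    have := SchwartzMap.one_add_le_sup_seminorm_apply (𝕜 := ℝ) (m := (3, 0)) (k := 3) (n := 0)
      le_rfl le_rfl (kernel α) y
    rwa [norm_iteratedFDeriv_zero] at this
  have hbd : ∀ r ∈ Ioo (r₀ / 2) (2 * r₀), ∀ z : E2,
      ‖dker α r z‖ ≤ ((r₀ / 2) ^ n)⁻¹ * (C * (1 + 2 * r₀) ^ 3) * (1 + ‖z‖) ^ (-3 : ℝ) := by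
    intro r hr z
    have hr0 : 0 < r := by linarith [hr.1]
    rw [Real.rpow_neg (by positivity), ← div_eq_mul_inv, le_div_iff₀ (by positivity)]
    have h3 : (1 + ‖z‖) ^ (3 : ℝ) = (1 + ‖z‖) ^ 3 := by
      exact_mod_cast Real.rpow_natCast (1 + ‖z‖) 3
    rw [h3, dker, norm_mul, mul_assoc]
    have h4 : ‖z‖ = r * ‖r⁻¹ • z‖ := by
      rw [norm_smul, Real.norm_of_nonneg (by positivity), ← mul_assoc, mul_inv_cancel₀ hr0.ne',
        one_mul]
    have h5 : 1 + ‖z‖ ≤ (1 + 2 * r₀) * (1 + ‖r⁻¹ • z‖) := by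
      rw [h4]
      have := norm_nonneg (r⁻¹ • z)
      nlinarith [hr.2]
    have h6 : ‖(r ^ n)⁻¹‖ ≤ ((r₀ / 2) ^ n)⁻¹ := by
      rw [Real.norm_of_nonneg (by positivity)]
      have := hr.1.le
      gcongr
    have h7 : ‖kernel α (r⁻¹ • z)‖ * (1 + ‖z‖) ^ 3 ≤ C * (1 + 2 * r₀) ^ 3 := by
      calc ‖kernel α (r⁻¹ • z)‖ * (1 + ‖z‖) ^ 3
          ≤ ‖kernel α (r⁻¹ • z)‖ * ((1 + 2 * r₀) * (1 + ‖r⁻¹ • z‖)) ^ 3 := by gcongr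
        _ = ((1 + ‖r⁻¹ • z‖) ^ 3 * ‖kernel α (r⁻¹ • z)‖) * (1 + 2 * r₀) ^ 3 := by ring
        _ ≤ _ := by gcongr; exact hC _
    exact mul_le_mul h6 h7 (by positivity) (by positivity)
  have key := MeasureTheory.tendsto_integral_filter_of_dominated_convergence (μ := volume)
    (l := 𝓝 r₀) (F := fun r z => ‖dker α r z - dker α r₀ z‖) (f := fun _ => (0 : ℝ))
    (fun z : E2 => ((r₀ / 2) ^ n)⁻¹ * (C * (1 + 2 * r₀) ^ 3) * (1 + ‖z‖) ^ (-3 : ℝ)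
      + ((r₀ / 2) ^ n)⁻¹ * (C * (1 + 2 * r₀) ^ 3) * (1 + ‖z‖) ^ (-3 : ℝ)) ?_ ?_ ?_ ?_
  · simpa using key
  · exact Eventually.of_forall fun r =>
      ((continuous_dker α r).sub (continuous_dker α r₀)).norm.aestronglyMeasurable
  · filter_upwards [Ioo_mem_nhds (show r₀ / 2 < r₀ by linarith) (show r₀ < 2 * r₀ by linarith)]
      with r hr
    refine Eventually.of_forall fun z => ?_
    rw [norm_norm]
    exact (norm_sub_le _ _).trans (add_le_add (hbd r hr z)
      (hbd r₀ ⟨by linarith, by linarith⟩ z))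
  · have hi : Integrable (fun z : E2 => (1 + ‖z‖) ^ (-3 : ℝ)) volume :=
      integrable_one_add_norm (by simp; norm_num)
    exact (hi.const_mul _).add (hi.const_mul _)
  · refine Eventually.of_forall fun z => ?_
    have hcont : ContinuousAt (fun r => ‖dker α r z - dker α r₀ z‖) r₀ := by
      unfold dker
      refine ((ContinuousAt.mul ?_ ?_).sub continuousAt_const).norm
      · exact (continuousAt_id.pow _).inv₀ (pow_ne_zero _ hr₀.ne')
      · exact (kernel α).continuous.continuousAt.comp
          ((continuousAt_id.inv₀ hr₀.ne').smul continuousAt_const)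
    simpa using hcont.tendsto

end Kernels

/-! ### The operators `∂^α e^{-τΔ²}` on `L^∞`: bounds and continuity in `τ`. -/

theorem fourthRoot {τ : ℝ} (hτ : 0 < τ) : 0 < τ ^ (1 / 4 : ℝ) ∧ (τ ^ (1 / 4 : ℝ)) ^ 4 = τ := by
  refine ⟨Real.rpow_pos_of_pos hτ _, ?_⟩
  rw [← Real.rpow_natCast, ← Real.rpow_mul hτ.le]
  norm_num

theorem exists_isMultiplier_sym (α : List (Fin 2)) {τ : ℝ} (hτ : 0 < τ) :
    ∃ A : Lp ℝ ∞ vol →L[ℝ] Lp ℝ ∞ vol, IsMultiplier A (sym α τ) := by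
  obtain ⟨hr, hr4⟩ := fourthRoot hτ
  obtain ⟨A, -, hA⟩ := exists_isMultiplier_ft (continuous_dker α _) (integrable_dker α hr)
  refine ⟨A, fun f k => ?_⟩
  rw [hA, ft_dker α hr, hr4]

open Classical in
/-- The operator `∂^α e^{-τΔ²}` on `L^∞` for `τ > 0`, and zero otherwise. -/
def op (α : List (Fin 2)) (τ : ℝ) : Lp ℝ ∞ vol →L[ℝ] Lp ℝ ∞ vol :=
  if h : 0 < τ then (exists_isMultiplier_sym α h).choose else 0

theorem op_of_nonpos (α : List (Fin 2)) {τ : ℝ} (hτ : ¬ 0 < τ) : op α τ = 0 := by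
  rw [op, dif_neg hτ]

theorem isMultiplier_op (α : List (Fin 2)) {τ : ℝ} (hτ : 0 < τ) :
    IsMultiplier (op α τ) (sym α τ) := by
  rw [op, dif_pos hτ]
  exact (exists_isMultiplier_sym α hτ).choose_spec

theorem coef_op (α : List (Fin 2)) {τ : ℝ} (hτ : 0 < τ) (f : Lp ℝ ∞ vol) (k : Fin 2 → ℤ) :
    coef k (op α τ f) = sym α τ k * coef k f := isMultiplier_op α hτ f k

theorem coef_op_cons (α : List (Fin 2)) (i : Fin 2) (τ : ℝ) (f : Lp ℝ ∞ vol) (k : Fin 2 → ℤ) :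
    coef k (op (i :: α) τ f) = 2 * Real.pi * Complex.I * k i * coef k (op α τ f) := by
  by_cases hτ : 0 < τ
  · simp only [coef_op _ hτ, sym, List.map_cons, List.prod_cons, mul_assoc]
  · simp [op_of_nonpos _ hτ]

theorem isMultiplier_op_fourthPow (α : List (Fin 2)) {r : ℝ} (hr : 0 < r) :
    IsMultiplier (op α (r ^ 4)) (ft (dker α r)) := fun f k => by
  rw [coef_op α (by positivity), ft_dker α hr]

theorem norm_op_fourthPow_le (α : List (Fin 2)) {r : ℝ} (hr : 0 < r) :
    ‖op α (r ^ 4)‖ ≤ (r ^ α.length)⁻¹ * ∫ z, ‖kernel α z‖ := by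
  obtain ⟨A, hA, hA'⟩ := exists_isMultiplier_ft (continuous_dker α r) (integrable_dker α hr)
  rw [(isMultiplier_op_fourthPow α hr).unique hA', ← integral_norm_dker α hr]
  exact hA

theorem norm_op_le (α : List (Fin 2)) {τ : ℝ} (hτ : 0 < τ) :
    ‖op α τ‖ ≤ (∫ z, ‖kernel α z‖) * τ ^ (-(α.length : ℝ) / 4) := by
  obtain ⟨hr, hr4⟩ := fourthRoot hτ
  have h := norm_op_fourthPow_le α hr
  rw [hr4] at h
  refine h.trans_eq ?_
  rw [mul_comm, ← Real.rpow_natCast, ← Real.rpow_mul hτ.le, ← Real.rpow_neg hτ.le]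
  congr 2
  ring

/-- The difference of two of these operators is convolution with the difference of their kernels, so
its operator norm is at most their `L¹` distance. Continuity is first obtained in the scale `r`,
then in `τ = r⁴`. -/
theorem continuousOn_op (α : List (Fin 2)) : ContinuousOn (op α) (Ioi 0) := by
  have h1 : ∀ r₀ : ℝ, 0 < r₀ → ContinuousAt (fun r => op α (r ^ 4)) r₀ := by
    intro r₀ hr₀
    rw [ContinuousAt, tendsto_iff_norm_sub_tendsto_zero]
    refine squeeze_zero' (Eventually.of_forall fun _ => norm_nonneg _) ?_
      (tendsto_integral_norm_dker_sub α hr₀)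
    filter_upwards [lt_mem_nhds hr₀] with r hr
    have hi := integrable_dker α hr
    have hi₀ := integrable_dker α hr₀
    obtain ⟨A, hA, hA'⟩ := exists_isMultiplier_ft
      ((continuous_dker α r).sub (continuous_dker α r₀)) (hi.sub hi₀)
    have hbdd : ∀ (r : ℝ) (k : Fin 2 → ℤ), 0 < r →
        Integrable fun z => mFourier (-k) (pr z) * (dker α r z : ℂ) := fun r k hr => by
      refine (integrable_dker α hr).ofReal.bdd_mul (c := 1)
        ((mFourier (-k)).continuous.comp continuous_pr).aestronglyMeasurable
        (Eventually.of_forall fun z => ?_)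
      rw [norm_mFourier_apply]
    have hm : IsMultiplier (op α (r ^ 4) - op α (r₀ ^ 4)) (ft (dker α r - dker α r₀)) := by
      intro f k
      rw [_root_.sub_apply, map_sub, isMultiplier_op_fourthPow α hr,
        isMultiplier_op_fourthPow α hr₀, ← sub_mul]
      congr 1
      unfold ft
      rw [← integral_sub (hbdd r k hr) (hbdd r₀ k hr₀)]
      simp [mul_sub]
    rw [hm.unique hA']
    exact hA
  intro τ hτ
  obtain ⟨hr, hr4⟩ := fourthRoot hτ
  have h2 : ContinuousAt (fun τ : ℝ => τ ^ (1 / 4 : ℝ)) τ :=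
    Real.continuousAt_rpow_const _ _ (Or.inr (by norm_num))
  have h3 := (h1 _ hr).comp (f := fun τ : ℝ => τ ^ (1 / 4 : ℝ)) h2
  refine (h3.congr ?_).continuousWithinAt
  filter_upwards [lt_mem_nhds hτ] with σ hσ
  simp only [Function.comp_apply, (fourthRoot hσ).2]

theorem integral_kernel_nil : ∫ z, kernel [] z = 1 := by
  have h := integral_exp_mul_kernel [] 0
  rw [symbol_apply] at h
  simp only [inner_zero_right, mul_zero, Complex.ofReal_zero, zero_mul, Complex.exp_zero, one_mul,
    List.map_nil, List.prod_nil, norm_zero, integral_complex_ofReal] at h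
  norm_num at h
  exact_mod_cast h

theorem integral_dker_nil {r : ℝ} (hr : 0 < r) : ∫ z, dker [] r z = 1 := by
  simp only [dker]
  rw [integral_const_mul, Measure.integral_comp_inv_smul_of_nonneg volume
    (fun z => kernel [] z) hr.le, integral_kernel_nil]
  have : Module.finrank ℝ E2 = 2 := by simp
  rw [this, smul_eq_mul]
  simp [hr.ne']

/-- On continuous functions the semigroup is strongly continuous at zero. -/
theorem tendsto_op_nil_of_continuous {f : Lp ℝ ∞ vol} (g : C(T2, ℝ)) (hfg : f =ᵐ[vol] g) :
    Tendsto (fun τ => op [] τ f) (𝓝[>] 0) (𝓝 f) := by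
  -- Currying makes `z ↦ g(· - z)` continuous into `C(T²)`, so the uniform displacement `η` is
  -- continuous with `η 0 = 0`: uniform continuity of `g` in a form suited to dominated convergence.
  set tr : C(E2, C(T2, ℝ)) := ContinuousMap.curry
    ⟨fun q : E2 × T2 => g (q.2 - pr q.1),
      g.continuous.comp (continuous_snd.sub (continuous_pr.comp continuous_fst))⟩ with htr
  set η : E2 → ℝ := fun z => ‖tr z - g‖ with hη
  have hηc : Continuous η := (tr.continuous.sub continuous_const).norm
  have hη0 : η 0 = 0 := by
    have : tr 0 = g := by
      ext x
      have : pr 0 = 0 := by funext i; simp [pr, proj]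
      simp [htr, this]
    simp [hη, this]
  have hηb : ∀ z, ‖η z‖ ≤ 2 * ‖g‖ := fun z => by
    rw [hη, norm_norm]
    have : ‖tr z‖ ≤ ‖g‖ := (ContinuousMap.norm_le _ (norm_nonneg _)).2 fun x =>
      g.norm_coe_le_norm _
    linarith [norm_sub_le (tr z) g]
  have hbound : ∀ r : ℝ, 0 < r → ‖op [] (r ^ 4) f - f‖ ≤ ∫ y, ‖kernel [] y‖ * η (r • y) := by
    intro r hr
    have h1 := norm_multiplier_sub_le (continuous_dker [] r) (integrable_dker [] hr)
      (integral_dker_nil hr) (isMultiplier_op_fourthPow [] hr) g.continuous hfg (η := η)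
      (fun x z => (tr z - g).norm_coe_le_norm x)
      ((integrable_dker [] hr).norm.mul_bdd hηc.aestronglyMeasurable
        (Eventually.of_forall hηb))
    refine h1.trans_eq ?_
    have h2 := Measure.integral_comp_inv_smul_of_nonneg (volume : Measure E2)
      (fun y => ‖kernel [] y‖ * η (r • y)) hr.le
    have hfin : Module.finrank ℝ E2 = 2 := by simp
    have h3 : (fun z => ‖dker [] r z‖ * η z)
        = fun z => (r ^ 2)⁻¹ * (‖kernel [] (r⁻¹ • z)‖ * η (r • r⁻¹ • z)) := by
      funext z
      rw [smul_inv_smul₀ hr.ne', dker, norm_mul, Real.norm_of_nonneg (by positivity)]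
      simp [mul_assoc]
    rw [h3, integral_const_mul, h2, hfin, smul_eq_mul, ← mul_assoc,
      inv_mul_cancel₀ (by positivity), one_mul]
  have hlim : Tendsto (fun r : ℝ => ∫ y, ‖kernel [] y‖ * η (r • y)) (𝓝 0) (𝓝 0) := by
    have key := MeasureTheory.tendsto_integral_filter_of_dominated_convergence
      (μ := (volume : Measure E2)) (l := 𝓝 (0 : ℝ))
      (F := fun (r : ℝ) y => ‖kernel [] y‖ * η (r • y)) (f := fun _ => (0 : ℝ))
      (fun y => ‖kernel [] y‖ * (2 * ‖g‖)) ?_ ?_ ?_ ?_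
    · simpa using key
    · exact Eventually.of_forall fun r => ((kernel []).continuous.norm.mul
        (hηc.comp (continuous_const_smul r))).aestronglyMeasurable
    · refine Eventually.of_forall fun r => Eventually.of_forall fun y => ?_
      rw [norm_mul, norm_norm]
      gcongr
      exact hηb _
    · exact ((kernel []).integrable (μ := volume)).norm.mul_const _
    · refine Eventually.of_forall fun y => ?_
      have : Continuous fun r : ℝ => ‖kernel [] y‖ * η (r • y) :=
        continuous_const.mul (hηc.comp (continuous_id.smul continuous_const))
      simpa [hη0] using this.tendsto 0
  rw [tendsto_iff_norm_sub_tendsto_zero]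
  have hroot : Tendsto (fun τ : ℝ => τ ^ (1 / 4 : ℝ)) (𝓝[>] 0) (𝓝 0) := by
    have : ContinuousAt (fun τ : ℝ => τ ^ (1 / 4 : ℝ)) 0 :=
      Real.continuousAt_rpow_const _ _ (Or.inr (by norm_num))
    have h := this.tendsto
    rw [Real.zero_rpow (by norm_num)] at h
    exact h.mono_left nhdsWithin_le_nhds
  refine squeeze_zero' (Eventually.of_forall fun _ => norm_nonneg _) ?_ (hlim.comp hroot)
  filter_upwards [self_mem_nhdsWithin] with τ hτ
  have := hbound _ (fourthRoot hτ).1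
  rwa [(fourthRoot hτ).2] at this

/-! ### Absolutely convergent Fourier series. -/

/-- A bounded function with summable Fourier coefficients is the sum of its Fourier series. -/
theorem ae_eq_tsum_of_summable {f : Lp ℝ ∞ vol} {c : (Fin 2 → ℤ) → ℂ} (hc : ∀ k, coef k f = c k)
    (hs : Summable fun k => ‖c k‖) :
    f =ᵐ[vol] fun x => (∑' k, c k * mFourier k x).re := by
  have hs' : Summable fun k => c k • (mFourier k : C(T2, ℂ)) := by
    refine Summable.of_norm ?_
    simpa only [norm_smul, mFourier_norm, mul_one] using hs
  set F : C(T2, ℂ) := ∑' k, c k • (mFourier k : C(T2, ℂ)) with hF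
  have hf := memLp_two (Lp.memLp f)
  -- The series converges to `f` in `L²`, and uniformly to `F` by summability; the two limits agree
  -- in `L²`.
  have h1 : HasSum (fun k => c k • ContinuousMap.toLp (E := ℂ) 2 vol ℂ (mFourier k))
      (hf.toLp _) := by
    have h : HasSum (fun k => fc (hf.toLp _) k • ContinuousMap.toLp (E := ℂ) 2 vol ℂ (mFourier k))
      (hf.toLp _) := hasSum_mFourier_series_L2 (d := Fin 2) (hf.toLp _)
    have e : ∀ k, fc (hf.toLp _) k = c k := fun k =>
      (fc_congr hf.coeFn_toLp k).trans (hc k)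
    simpa only [e] using h
  have h2 : HasSum (fun k => c k • ContinuousMap.toLp (E := ℂ) 2 vol ℂ (mFourier k))
      (ContinuousMap.toLp (E := ℂ) 2 vol ℂ F) := by
    have := (ContinuousMap.toLp (E := ℂ) 2 vol ℂ).hasSum hs'.hasSum
    simpa only [map_smul] using this
  have h3 := h1.unique h2
  have h4 : (fun x => (f x : ℂ)) =ᵐ[vol] F :=
    (hf.coeFn_toLp.symm.trans (by rw [h3])).trans (ContinuousMap.coeFn_toLp vol F)
  filter_upwards [h4] with x hx
  have h5 : F x = ∑' k, c k * mFourier k x := by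
    have := (ContinuousMap.evalCLM ℂ x).map_tsum hs'
    simpa using this
  rw [← h5, ← hx, Complex.ofReal_re]

theorem summable_norm_sym (α : List (Fin 2)) {τ : ℝ} (hτ : 0 < τ) :
    Summable fun k => ‖sym α τ k‖ := by
  obtain ⟨hr, hr4⟩ := fourthRoot hτ
  set r := τ ^ (1 / 4 : ℝ)
  obtain ⟨C, hC⟩ := (symbol α).decay' 3 0
  have hs : Summable fun k : Fin 2 → ℤ =>
      (r ^ α.length)⁻¹ * ((r ^ 3)⁻¹ * C) * ‖k‖ ^ (-3 : ℝ) :=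
    (EisensteinSeries.summable_one_div_norm_rpow (by norm_num)).mul_left _
  refine Summable.of_norm_bounded_eventually hs ?_
  -- At `k = 0` the majorant is zero, since `0 ^ (-3) = 0` by convention, so this one point is
  -- discarded. Elsewhere cubic decay suffices on a lattice of rank two.
  filter_upwards [(finite_singleton (0 : Fin 2 → ℤ)).compl_mem_cofinite] with k hk
  have hk0 : 0 < ‖k‖ := norm_pos_iff.2 hk
  have hle : ‖k‖ ≤ ‖intPt k‖ := by
    refine (pi_norm_le_iff_of_nonneg (norm_nonneg _)).2 fun i => ?_
    have := PiLp.norm_apply_le (intPt k) i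
    simpa [intPt, Int.norm_eq_abs] using this
  have h1 : ‖symbol α (r • intPt k)‖ ≤ (r ^ 3)⁻¹ * C * ‖k‖ ^ (-3 : ℝ) := by
    have h := hC (r • intPt k)
    rw [norm_iteratedFDeriv_zero, norm_smul, Real.norm_of_nonneg hr.le, mul_pow] at h
    have h3 : ‖k‖ ^ (-3 : ℝ) = (‖k‖ ^ 3)⁻¹ := by
      rw [Real.rpow_neg hk0.le]
      congr 1
      exact_mod_cast Real.rpow_natCast ‖k‖ 3
    have h4 : r ^ 3 * ‖k‖ ^ 3 * ‖symbol α (r • intPt k)‖ ≤ C :=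
      le_trans (by gcongr; exact le_rfl) h
    rw [h3]
    calc ‖symbol α (r • intPt k)‖
        = (r ^ 3)⁻¹ * (r ^ 3 * ‖k‖ ^ 3 * ‖symbol α (r • intPt k)‖) * (‖k‖ ^ 3)⁻¹ := by
          field_simp
      _ ≤ _ := by gcongr
  rw [norm_norm, ← hr4, sym_eq_symbol α hr, norm_mul, Complex.norm_real,
    Real.norm_of_nonneg (by positivity), mul_assoc]
  gcongr

/-! ### The semigroup and its divergence form on `W^{1,∞}`. -/

/-- The vector field with `i`-th component `f` and other components zero. -/
def incl (i : Fin 2) : Lp ℝ ∞ vol →L[ℝ] Lp E2 ∞ vol :=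
  (ContinuousLinearMap.toSpanSingleton ℝ (EuclideanSpace.single i 1 : E2)).compLpL ∞ vol

theorem coeFn_incl (i : Fin 2) (f : Lp ℝ ∞ vol) :
    incl i f =ᵐ[vol] fun x => f x • (EuclideanSpace.single i 1 : E2) := by
  filter_upwards [ContinuousLinearMap.coeFn_compLpL (p := ∞) (μ := vol)
    (ContinuousLinearMap.toSpanSingleton ℝ (EuclideanSpace.single i 1 : E2)) f] with x hx
  exact hx

theorem comp_incl (i j : Fin 2) (f : Lp ℝ ∞ vol) :
    comp j (incl i f) = if j = i then f else 0 := by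
  refine Lp.ext ?_
  split_ifs with h
  · filter_upwards [coeFn_comp j (incl i f), coeFn_incl i f] with x h1 h2
    rw [h1, h2]
    simp [h]
  · filter_upwards [coeFn_comp j (incl i f), coeFn_incl i f, Lp.coeFn_zero ℝ ∞ vol] with x h1 h2 h3
    rw [h1, h2, h3]
    simp [h]

theorem comp_sum_incl (j : Fin 2) (f : Fin 2 → Lp ℝ ∞ vol) :
    comp j (∑ i, incl i (f i)) = f j := by
  simp only [map_sum, comp_incl, Finset.sum_ite_eq, Finset.mem_univ, if_true]

theorem ext_comp {g h : Lp E2 ∞ vol} (H : ∀ j, comp j g = comp j h) : g = h := by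
  refine Lp.ext ?_
  have h1 : ∀ j, ∀ᵐ x ∂vol, g x j = h x j := fun j => by
    filter_upwards [coeFn_comp j g, coeFn_comp j h] with x h1 h2
    rw [← h1, ← h2, H]
  filter_upwards [ae_all_iff.2 h1] with x hx
  exact PiLp.ext hx

theorem sum_incl_comp (g : Lp E2 ∞ vol) : ∑ i, incl i (comp i g) = g :=
  ext_comp fun j => comp_sum_incl j _

theorem norm_comp_le (i : Fin 2) (g : Lp E2 ∞ vol) : ‖comp i g‖ ≤ ‖g‖ := by
  refine norm_le_of_ae_le (norm_nonneg _) ?_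
  filter_upwards [coeFn_comp i g, norm_coe_le E2 g] with x h1 h2
  rw [h1]
  exact (PiLp.norm_apply_le _ _).trans h2

theorem norm_incl_le (i : Fin 2) (f : Lp ℝ ∞ vol) : ‖incl i f‖ ≤ ‖f‖ := by
  refine norm_le_of_ae_le (norm_nonneg _) ?_
  filter_upwards [coeFn_incl i f, norm_coe_le ℝ f] with x h1 h2
  rw [h1, norm_smul]
  simpa using h2

theorem coef_comp_grad (w : W1Inf) (i : Fin 2) (k : Fin 2 → ℤ) :
    coef k (comp i (grad w)) = 2 * Real.pi * Complex.I * k i * coef k (fn w) :=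
  (isWeakGradient_iff _ _).1 w.2 i k

/-- The coefficients of the gradient are multiples of those of the function. Equality in `W^{1,∞}`
can thus be checked on functions alone, which is all the definition of a mild solution specifies. -/
theorem fn_injective : Function.Injective fn := by
  intro v w h
  refine Subtype.ext (Prod.ext h (ext_comp fun j => ext_coef fun k => ?_))
  exact (coef_comp_grad v j k).trans ((congrArg _ (congrArg _ h)).trans (coef_comp_grad w j k).symm)

theorem norm_W1Inf (w : W1Inf) : ‖w‖ = max ‖fn w‖ ‖grad w‖ := rfl

theorem norm_fn_le (w : W1Inf) : ‖fn w‖ ≤ ‖w‖ := le_max_left _ _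

theorem norm_grad_le (w : W1Inf) : ‖grad w‖ ≤ ‖w‖ := le_max_right _ _

theorem continuous_fn : Continuous fn := continuous_fst.comp continuous_subtype_val

theorem continuous_grad : Continuous grad := continuous_snd.comp continuous_subtype_val

/-- The semigroup `e^{-τΔ²}` acting on a function and its weak gradient. -/
def heat (τ : ℝ) (w : W1Inf) : W1Inf :=
  ⟨(op [] τ (fn w), ∑ i, incl i (op [] τ (comp i (grad w)))), by
    refine (isWeakGradient_iff _ _).2 fun i k => ?_
    dsimp only
    rw [comp_sum_incl]
    by_cases hτ : 0 < τ
    · rw [coef_op _ hτ, coef_op _ hτ, coef_comp_grad]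
      ring
    · simp [op_of_nonpos _ hτ]⟩

theorem fn_heat (τ : ℝ) (w : W1Inf) : fn (heat τ w) = op [] τ (fn w) := rfl

theorem grad_heat (τ : ℝ) (w : W1Inf) :
    grad (heat τ w) = ∑ i, incl i (op [] τ (comp i (grad w))) := rfl

/-- The linear map `G ↦ ∇·e^{-τΔ²}G` from `L^∞` to `W^{1,∞}`. -/
def divHeat (τ : ℝ) : Lp E2 ∞ vol →L[ℝ] W1Inf :=
  ((∑ j, (op [j] τ).comp (comp j)).prod
    (∑ i, (incl i).comp (∑ j, (op [i, j] τ).comp (comp j)))).codRestrict W1Inf fun G => by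
    refine (isWeakGradient_iff _ _).2 fun i k => ?_
    simp only [ContinuousLinearMap.prod_apply, _root_.sum_apply,
      ContinuousLinearMap.comp_apply, comp_sum_incl]
    rw [map_sum, map_sum, Finset.mul_sum]
    exact Finset.sum_congr rfl fun j _ => coef_op_cons _ _ _ _ _

theorem fn_divHeat (τ : ℝ) (G : Lp E2 ∞ vol) : fn (divHeat τ G) = ∑ j, op [j] τ (comp j G) := by
  change (∑ j, (op [j] τ).comp (comp j)) G = _
  simp

theorem grad_divHeat (τ : ℝ) (G : Lp E2 ∞ vol) :
    grad (divHeat τ G) = ∑ i, incl i (∑ j, op [i, j] τ (comp j G)) := by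
  change (∑ i, (incl i).comp (∑ j, (op [i, j] τ).comp (comp j))) G = _
  simp

/-- The semigroup commutes with the gradient, so no derivative falls on the kernel and the bound is
uniform in `τ`. The factor 2 in the constant counts the components of the gradient. -/
theorem exists_norm_heat_le : ∃ C : ℝ, 0 ≤ C ∧ ∀ τ, 0 < τ → ∀ w, ‖heat τ w‖ ≤ C * ‖w‖ := by
  set K := ∫ z, ‖kernel [] z‖ with hK
  have hK0 : 0 ≤ K := integral_nonneg fun _ => norm_nonneg _
  refine ⟨2 * K, by positivity, fun τ hτ w => ?_⟩
  have hop : ∀ f, ‖op [] τ f‖ ≤ K * ‖f‖ := fun f => by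
    refine ContinuousLinearMap.le_of_opNorm_le _ ?_ f
    simpa only [List.length_nil, Nat.cast_zero, neg_zero, zero_div, Real.rpow_zero, mul_one]
      using norm_op_le [] hτ
  rw [norm_W1Inf]
  refine max_le ?_ ?_
  · rw [fn_heat]
    calc _ ≤ K * ‖fn w‖ := hop _
      _ ≤ K * ‖w‖ := by gcongr; exact norm_fn_le w
      _ ≤ 2 * K * ‖w‖ := by nlinarith [mul_nonneg hK0 (norm_nonneg w)]
  · rw [grad_heat]
    calc _ ≤ ∑ i : Fin 2, K * ‖w‖ := norm_sum_le_of_le _ fun i _ => by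
          refine (norm_incl_le _ _).trans ((hop _).trans ?_)
          gcongr
          exact (norm_comp_le _ _).trans (norm_grad_le w)
      _ = 2 * K * ‖w‖ := by simp; ring

/-- The function part costs one derivative, `τ^{-1/4}`, and the gradient part two, `τ^{-1/2}`; for
`τ ≤ 1` the latter dominates. -/
theorem exists_norm_divHeat_le :
    ∃ C : ℝ, 0 ≤ C ∧ ∀ τ, 0 < τ → τ ≤ 1 → ∀ G,
      ‖divHeat τ G‖ ≤ C * τ ^ (-(1 / 2) : ℝ) * ‖G‖ := by
  have hn : ∀ α, 0 ≤ ∫ z, ‖kernel α z‖ := fun α => integral_nonneg fun _ => norm_nonneg _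
  obtain ⟨K₁, hK₁⟩ : ∃ K, K = ∑ j : Fin 2, ∫ z, ‖kernel [j] z‖ := ⟨_, rfl⟩
  obtain ⟨K₂, hK₂⟩ : ∃ K, K = ∑ i : Fin 2, ∑ j : Fin 2, ∫ z, ‖kernel [i, j] z‖ := ⟨_, rfl⟩
  have h₁ : 0 ≤ K₁ := hK₁ ▸ Finset.sum_nonneg fun j _ => hn _
  have h₂ : 0 ≤ K₂ := hK₂ ▸ Finset.sum_nonneg fun i _ => Finset.sum_nonneg fun j _ => hn _
  refine ⟨K₁ + K₂, add_nonneg h₁ h₂, fun τ hτ hτ1 G => ?_⟩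
  have hr : 0 ≤ τ ^ (-(1 / 2) : ℝ) := Real.rpow_nonneg hτ.le _
  have hop : ∀ α : List (Fin 2), α.length ≤ 2 → ∀ j,
      ‖op α τ (comp j G)‖ ≤ (∫ z, ‖kernel α z‖) * (τ ^ (-(1 / 2) : ℝ) * ‖G‖) := fun α hα j => by
    have hα' : (α.length : ℝ) ≤ 2 := by exact_mod_cast hα
    calc ‖op α τ (comp j G)‖ ≤ ((∫ z, ‖kernel α z‖) * τ ^ (-(α.length : ℝ) / 4)) * ‖comp j G‖ :=
          ContinuousLinearMap.le_of_opNorm_le _ (norm_op_le α hτ) _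
      _ ≤ ((∫ z, ‖kernel α z‖) * τ ^ (-(1 / 2) : ℝ)) * ‖G‖ :=
          mul_le_mul (mul_le_mul_of_nonneg_left
            (Real.rpow_le_rpow_of_exponent_ge hτ hτ1 (by linarith)) (hn α)) (norm_comp_le j G)
            (norm_nonneg _) (mul_nonneg (hn α) hr)
      _ = _ := by ring
  rw [norm_W1Inf]
  have hG : 0 ≤ τ ^ (-(1 / 2) : ℝ) * ‖G‖ := mul_nonneg hr (norm_nonneg _)
  refine max_le ?_ ?_
  · rw [fn_divHeat]
    calc _ ≤ ∑ j : Fin 2, (∫ z, ‖kernel [j] z‖) * (τ ^ (-(1 / 2) : ℝ) * ‖G‖) :=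
          norm_sum_le_of_le _ fun j _ => hop _ (by simp) j
      _ = K₁ * (τ ^ (-(1 / 2) : ℝ) * ‖G‖) := by rw [hK₁, Finset.sum_mul]
      _ ≤ _ := by nlinarith [mul_nonneg h₂ hG]
  · rw [grad_divHeat]
    calc _ ≤ ∑ i : Fin 2, ∑ j : Fin 2, (∫ z, ‖kernel [i, j] z‖) * (τ ^ (-(1 / 2) : ℝ) * ‖G‖) :=
          norm_sum_le_of_le _ fun i _ => (norm_incl_le _ _).trans
            (norm_sum_le_of_le _ fun j _ => hop _ (by simp) j)
      _ = K₂ * (τ ^ (-(1 / 2) : ℝ) * ‖G‖) := by simp only [hK₂, Finset.sum_mul]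
      _ ≤ _ := by nlinarith [mul_nonneg h₁ hG]

theorem continuousOn_heat (w : W1Inf) : ContinuousOn (fun τ => heat τ w) (Ioi 0) := by
  rw [continuousOn_iff_continuous_domRestrict]
  have h0 : Continuous fun τ : Ioi (0 : ℝ) => op [] τ.1 :=
    continuousOn_iff_continuous_domRestrict.1 (continuousOn_op [])
  refine Continuous.subtype_mk (Continuous.prodMk ?_ ?_) _
  · exact h0.clm_apply continuous_const
  · refine continuous_finsetSum _ fun i _ => (incl i).continuous.comp ?_
    exact h0.clm_apply continuous_const

theorem continuousOn_divHeat : ContinuousOn (fun q : ℝ × Lp E2 ∞ vol => divHeat q.1 q.2)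
    (Ioi 0 ×ˢ univ) := by
  rw [continuousOn_iff_continuous_domRestrict]
  have h0 : ∀ α, Continuous fun q : (Ioi (0 : ℝ) ×ˢ (univ : Set (Lp E2 ∞ vol)) : Set _) =>
      op α q.1.1 := fun α =>
    (continuousOn_op α).comp_continuous (continuous_fst.comp continuous_subtype_val)
      fun q => q.2.1
  refine continuous_induced_rng.2 (Continuous.prodMk ?_ ?_)
  · refine Continuous.congr (f := fun q : (Ioi (0 : ℝ) ×ˢ (univ : Set (Lp E2 ∞ vol)) : Set _) =>
      ∑ j, op [j] q.1.1 (comp j q.1.2)) ?_ fun q => (fn_divHeat _ _).symm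
    exact continuous_finsetSum _ fun j _ => (h0 _).clm_apply
      ((comp j).continuous.comp (continuous_snd.comp continuous_subtype_val))
  · refine Continuous.congr (f := fun q : (Ioi (0 : ℝ) ×ˢ (univ : Set (Lp E2 ∞ vol)) : Set _) =>
      ∑ i, incl i (∑ j, op [i, j] q.1.1 (comp j q.1.2))) ?_ fun q => (grad_divHeat _ _).symm
    exact continuous_finsetSum _ fun i _ => (incl i).continuous.comp
      (continuous_finsetSum _ fun j _ => (h0 _).clm_apply
        ((comp j).continuous.comp (continuous_snd.comp continuous_subtype_val)))

/-! ### Agreement with the Fourier series defining the semigroup. -/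

theorem semigroup_eq (τ : ℝ) (f : T2 → ℝ) (x : T2) :
    semigroup τ f x = (∑' k, sym [] τ k * fc (fun y => (f y : ℂ)) k * mFourier k x).re := by
  simp only [semigroup, sym, List.map_nil, List.prod_nil, one_mul, mFourierCoeff_eq_fc]

theorem summable_norm_sym_mul (α : List (Fin 2)) {τ : ℝ} (hτ : 0 < τ) (f : Lp ℝ ∞ vol) :
    Summable fun k => ‖sym α τ k * coef k f‖ := by
  refine Summable.of_nonneg_of_le (fun _ => norm_nonneg _) (fun k => ?_)
    ((summable_norm_sym α hτ).mul_right ‖f‖)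
  rw [norm_mul]
  gcongr
  refine ((coef k).le_of_opNorm_le ?_ f).trans_eq (one_mul _)
  exact LinearMap.mkContinuous_norm_le _ zero_le_one _

theorem op_ae_eq (α : List (Fin 2)) {τ : ℝ} (hτ : 0 < τ) (f : Lp ℝ ∞ vol) :
    op α τ f =ᵐ[vol] fun x => (∑' k, sym α τ k * coef k f * mFourier k x).re :=
  ae_eq_tsum_of_summable (coef_op α hτ f) (summable_norm_sym_mul α hτ f)

theorem fn_heat_ae_eq {τ : ℝ} (hτ : 0 < τ) (w : W1Inf) :
    fn (heat τ w) =ᵐ[vol] semigroup τ (fn w) := by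
  filter_upwards [op_ae_eq [] hτ (fn w)] with x hx
  rw [fn_heat, hx, semigroup_eq]
  rfl

/-- Termwise differentiation is allowed because the symbol times `k_j` is still absolutely summable.
-/
theorem partialD_semigroup (j : Fin 2) {τ : ℝ} (hτ : 0 < τ) {f : T2 → ℝ} {f' : Lp ℝ ∞ vol}
    (hf : f' =ᵐ[vol] f) (x : T2) :
    partialD j (semigroup τ f) x = (∑' k, sym [j] τ k * coef k f' * mFourier k x).re := by
  have hc : ∀ k, fc (fun y => (f y : ℂ)) k = coef k f' := fun k => fc_congr (by
    filter_upwards [hf] with x hx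
    rw [hx]) k
  have hs1 : ∀ k, sym [j] τ k = 2 * Real.pi * Complex.I * k j * sym [] τ k := fun k => by
    simp [sym]
  have hd : ∀ k (y : ℝ), HasDerivAt (fun h : ℝ => sym [] τ k * coef k f'
      * mFourier k (x + Pi.single j (h : UnitAddCircle)))
      (sym [j] τ k * coef k f' * mFourier k (x + Pi.single j (y : UnitAddCircle))) y := by
    intro k y
    have h1 := hasDerivAt_mFourier_single k j (x + Pi.single j (y : UnitAddCircle))
    have h2 : HasDerivAt (fun h : ℝ => h - y) 1 y := (hasDerivAt_id y).sub_const y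
    have h3 : HasDerivAt (fun h : ℝ => mFourier k (x + Pi.single j (h : UnitAddCircle)))
        (2 * Real.pi * Complex.I * k j * mFourier k (x + Pi.single j (y : UnitAddCircle))) y := by
      have h4 := HasDerivAt.scomp_of_eq (h := fun h : ℝ => h - y) y h1 h2 (by simp)
      rw [one_smul] at h4
      refine h4.congr_of_eventuallyEq (Eventually.of_forall fun h => ?_)
      simp only [Function.comp_apply, mFourier_add_apply, mFourier_single_coe]
      rw [mul_assoc (mFourier k x), ← Complex.exp_add]
      congr 2
      push_cast
      ring
    refine (h3.const_mul _).congr_deriv ?_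
    rw [hs1]
    ring
  have hsum := hasDerivAt_tsum (summable_norm_sym_mul [j] hτ f') hd (fun k y => by
      rw [norm_mul, norm_mFourier_apply, mul_one]) (y₀ := 0) (Summable.of_norm (by
      simpa only [norm_mul _ (mFourier _ _), norm_mFourier_apply, mul_one] using
        summable_norm_sym_mul [] hτ f')) 0
  have hre := Complex.reCLM.hasFDerivAt.comp_hasDerivAt _ hsum
  unfold partialD
  simp only [semigroup_eq, hc]
  refine hre.deriv.trans ?_
  simp

theorem fn_divHeat_ae_eq {τ : ℝ} (hτ : 0 < τ) {G : T2 → E2} {G' : Lp E2 ∞ vol}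
    (hG : G' =ᵐ[vol] G) : fn (divHeat τ G') =ᵐ[vol] divSemigroup τ G := by
  have hj : ∀ j, comp j G' =ᵐ[vol] fun y => G y j := fun j => by
    filter_upwards [coeFn_comp j G', hG] with x h1 h2
    rw [h1, h2]
  rw [fn_divHeat]
  simp only [Fin.sum_univ_two]
  filter_upwards [Lp.coeFn_add (op [0] τ (comp 0 G')) (op [1] τ (comp 1 G')),
    op_ae_eq [0] hτ (comp 0 G'), op_ae_eq [1] hτ (comp 1 G')] with x h1 h2 h3
  rw [h1, Pi.add_apply, h2, h3, divSemigroup, Fin.sum_univ_two, partialD_semigroup 0 hτ (hj 0),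
    partialD_semigroup 1 hτ (hj 1)]

/-! ### Lipschitz estimates for the nonlinearity. -/

theorem continuous_flux {p : ℝ} (hp : 2 < p) : Continuous (flux p) := by
  unfold flux
  exact (continuous_norm.rpow_const fun _ => Or.inr (by linarith)).smul continuous_id

theorem norm_flux_sub_le_of_norm_le {p : ℝ} (hp2 : 2 < p) (hp3 : p < 3) {ξ ζ : E2}
    (h : ‖ζ‖ ≤ ‖ξ‖) : ‖flux p ξ - flux p ζ‖ ≤ 2 * ‖ξ‖ ^ (p - 2) * ‖ξ - ζ‖ := by
  have hq : 0 ≤ p - 2 := by linarith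
  have hmono : ‖ζ‖ ^ (p - 2) ≤ ‖ξ‖ ^ (p - 2) := Real.rpow_le_rpow (norm_nonneg _) h hq
  have hsplit : flux p ξ - flux p ζ
      = ‖ξ‖ ^ (p - 2) • (ξ - ζ) + (‖ξ‖ ^ (p - 2) - ‖ζ‖ ^ (p - 2)) • ζ := by
    unfold flux
    rw [smul_sub, sub_smul]
    abel
  have hsecond : (‖ξ‖ ^ (p - 2) - ‖ζ‖ ^ (p - 2)) * ‖ζ‖ ≤ ‖ξ‖ ^ (p - 2) * ‖ξ - ζ‖ := by
    rcases (norm_nonneg ζ).eq_or_lt with h0 | h0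
    · rw [← h0, mul_zero]
      positivity
    · have hξ : 0 < ‖ξ‖ := h0.trans_le h
      -- This says that `x ↦ x^{p-3}` is decreasing, which is where `p < 3` enters; it is written
      -- with the increasing power `x^{3-p}`.
      have key : ‖ξ‖ ^ (p - 2) * ‖ζ‖ ≤ ‖ζ‖ ^ (p - 2) * ‖ξ‖ := by
        have e : ∀ x : ℝ, 0 < x → x = x ^ (p - 2) * x ^ (3 - p) := fun x hx => by
          rw [← Real.rpow_add hx]
          norm_num
        have h1 : ‖ζ‖ ^ (3 - p) ≤ ‖ξ‖ ^ (3 - p) :=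
          Real.rpow_le_rpow (norm_nonneg _) h (by linarith)
        calc ‖ξ‖ ^ (p - 2) * ‖ζ‖ = ‖ξ‖ ^ (p - 2) * (‖ζ‖ ^ (p - 2) * ‖ζ‖ ^ (3 - p)) := by
              rw [← e _ h0]
          _ ≤ ‖ξ‖ ^ (p - 2) * (‖ζ‖ ^ (p - 2) * ‖ξ‖ ^ (3 - p)) := by gcongr
          _ = ‖ζ‖ ^ (p - 2) * (‖ξ‖ ^ (p - 2) * ‖ξ‖ ^ (3 - p)) := by ring
          _ = ‖ζ‖ ^ (p - 2) * ‖ξ‖ := by rw [← e _ hξ]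
      calc (‖ξ‖ ^ (p - 2) - ‖ζ‖ ^ (p - 2)) * ‖ζ‖ ≤ ‖ζ‖ ^ (p - 2) * (‖ξ‖ - ‖ζ‖) := by linarith
        _ ≤ ‖ξ‖ ^ (p - 2) * ‖ξ - ζ‖ := by
          gcongr
          exact norm_sub_norm_le ξ ζ
  rw [hsplit]
  refine (norm_add_le _ _).trans ?_
  rw [norm_smul, norm_smul, Real.norm_of_nonneg (by positivity),
    Real.norm_of_nonneg (sub_nonneg.2 hmono)]
  linarith

theorem norm_flux_sub_le {p : ℝ} (hp2 : 2 < p) (hp3 : p < 3) {R : ℝ} {ξ ζ : E2}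
    (hξ : ‖ξ‖ ≤ R) (hζ : ‖ζ‖ ≤ R) : ‖flux p ξ - flux p ζ‖ ≤ 2 * R ^ (p - 2) * ‖ξ - ζ‖ := by
  have hq : 0 ≤ p - 2 := by linarith
  rcases le_total ‖ζ‖ ‖ξ‖ with h | h
  · refine (norm_flux_sub_le_of_norm_le hp2 hp3 h).trans ?_
    gcongr
  · rw [norm_sub_rev, norm_sub_rev ξ]
    refine (norm_flux_sub_le_of_norm_le hp2 hp3 h).trans ?_
    gcongr

theorem memLp_flux {p : ℝ} (hp2 : 2 < p) (g : Lp E2 ∞ vol) :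
    MemLp (fun x => flux p (g x)) ∞ vol := by
  refine memLp_top_of_bound ((continuous_flux hp2).comp_aestronglyMeasurable
    (Lp.aestronglyMeasurable g)) (‖g‖ ^ (p - 2) * ‖g‖) ?_
  filter_upwards [norm_coe_le E2 g] with x hx
  rw [flux, norm_smul, Real.norm_of_nonneg (by positivity)]
  have hq : 0 ≤ p - 2 := by linarith
  gcongr

/-- The nonlinearity acting on bounded vector fields. -/
def fluxLp {p : ℝ} (hp2 : 2 < p) (g : Lp E2 ∞ vol) : Lp E2 ∞ vol := (memLp_flux hp2 g).toLp _

theorem coeFn_fluxLp {p : ℝ} (hp2 : 2 < p) (g : Lp E2 ∞ vol) :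
    fluxLp hp2 g =ᵐ[vol] fun x => flux p (g x) := (memLp_flux hp2 g).coeFn_toLp

theorem norm_fluxLp_sub_le {p : ℝ} (hp2 : 2 < p) (hp3 : p < 3) {R : ℝ} {g h : Lp E2 ∞ vol}
    (hg : ‖g‖ ≤ R) (hh : ‖h‖ ≤ R) :
    ‖fluxLp hp2 g - fluxLp hp2 h‖ ≤ 2 * R ^ (p - 2) * ‖g - h‖ := by
  have hR : 0 ≤ R := (norm_nonneg _).trans hg
  refine norm_le_of_ae_le (by positivity) ?_
  filter_upwards [Lp.coeFn_sub (fluxLp hp2 g) (fluxLp hp2 h), coeFn_fluxLp hp2 g,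
    coeFn_fluxLp hp2 h, norm_coe_le E2 g, norm_coe_le E2 h, norm_coe_le E2 (g - h),
    Lp.coeFn_sub g h] with x h1 h2 h3 h4 h5 h6 h7
  rw [h1, Pi.sub_apply, h2, h3]
  rw [h7, Pi.sub_apply] at h6
  refine (norm_flux_sub_le hp2 hp3 (h4.trans hg) (h5.trans hh)).trans ?_
  gcongr

theorem fluxLp_zero {p : ℝ} (hp2 : 2 < p) : fluxLp hp2 0 = 0 := by
  refine Lp.ext ?_
  filter_upwards [coeFn_fluxLp hp2 0, Lp.coeFn_zero E2 ∞ vol] with x h1 h2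
  rw [h1, h2]
  simp [flux]

theorem continuous_fluxLp {p : ℝ} (hp2 : 2 < p) (hp3 : p < 3) : Continuous (fluxLp hp2) := by
  refine continuous_iff_continuousAt.2 fun g => ?_
  rw [ContinuousAt, tendsto_iff_norm_sub_tendsto_zero]
  have h1 : Tendsto (fun h : Lp E2 ∞ vol => 2 * (‖g‖ + 1) ^ (p - 2) * ‖h - g‖) (𝓝 g) (𝓝 0) := by
    have : Continuous fun h : Lp E2 ∞ vol => 2 * (‖g‖ + 1) ^ (p - 2) * ‖h - g‖ := by fun_prop
    simpa using this.tendsto g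
  refine squeeze_zero' (Eventually.of_forall fun _ => norm_nonneg _) ?_ h1
  filter_upwards [Metric.ball_mem_nhds g one_pos] with h hh
  refine norm_fluxLp_sub_le hp2 hp3 ?_ (by linarith)
  rw [Metric.mem_ball, dist_eq_norm] at hh
  have := norm_add_le (h - g) g
  rw [sub_add_cancel] at this
  linarith

/-! ### Volterra equations with a weakly singular kernel. -/

/-- A nonlinear kernel with an integrable singularity at `τ = 0`, locally Lipschitz in the state. -/
structure IsWeaklySingular {X : Type*} [NormedAddCommGroup X] (K : ℝ → X → X) (L : ℝ → ℝ) :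
    Prop where
  continuousOn : ContinuousOn (Function.uncurry K) (Ioi 0 ×ˢ univ)
  nonneg : ∀ R, 0 ≤ R → 0 ≤ L R
  zero : ∀ τ, K τ 0 = 0
  lipschitz : ∀ R τ w w', 0 < τ → τ ≤ 1 → ‖w‖ ≤ R → ‖w'‖ ≤ R →
    ‖K τ w - K τ w'‖ ≤ L R * τ ^ (-(1 / 2) : ℝ) * ‖w - w'‖

theorem intervalIntegrable_sub_rpow (t a : ℝ) :
    IntervalIntegrable (fun s => (t - s) ^ (-(1 / 2) : ℝ)) volume a t := by
  have h : IntervalIntegrable (fun s : ℝ => s ^ (-(1 / 2) : ℝ)) volume (t - a) (t - t) :=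
    intervalIntegral.intervalIntegrable_rpow' (by norm_num)
  simpa using h.comp_sub_left t

theorem integral_sub_rpow (t a : ℝ) :
    ∫ s in a..t, (t - s) ^ (-(1 / 2) : ℝ) = 2 * (t - a) ^ (1 / 2 : ℝ) := by
  rw [intervalIntegral.integral_comp_sub_left (fun s => s ^ (-(1 / 2) : ℝ)), sub_self,
    integral_rpow (Or.inl (by norm_num))]
  norm_num
  ring

section Volterra

variable {X : Type*} [NormedAddCommGroup X] {K : ℝ → X → X} {L : ℝ → ℝ}

theorem IsWeaklySingular.norm_le (hK : IsWeaklySingular K L) {R τ : ℝ} {w : X} (hτ : 0 < τ)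
    (hτ1 : τ ≤ 1) (hw : ‖w‖ ≤ R) : ‖K τ w‖ ≤ L R * R * τ ^ (-(1 / 2) : ℝ) := by
  have hR : 0 ≤ R := (norm_nonneg _).trans hw
  have h := hK.lipschitz R τ w 0 hτ hτ1 hw (by simpa using hR)
  rw [hK.zero, sub_zero, sub_zero] at h
  refine h.trans ?_
  have := hK.nonneg R hR
  have := Real.rpow_nonneg hτ.le (-(1 / 2))
  calc L R * τ ^ (-(1 / 2) : ℝ) * ‖w‖ ≤ L R * τ ^ (-(1 / 2) : ℝ) * R := by gcongr
    _ = _ := by ring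

theorem IsWeaklySingular.continuousOn_comp (hK : IsWeaklySingular K L) {T : ℝ} {u : ℝ → X}
    (hu : ContinuousOn u (Ioc 0 T)) {t : ℝ} (ht : t ∈ Ioc 0 T) :
    ContinuousOn (fun s => K (t - s) (u s)) (Ioo 0 t) := by
  refine hK.continuousOn.comp (f := fun s => (t - s, u s)) ?_ fun s hs => ?_
  · exact (continuousOn_const.sub continuousOn_id).prodMk
      (hu.mono fun s hs => ⟨hs.1, hs.2.le.trans ht.2⟩)
  · exact ⟨sub_pos.2 hs.2, mem_univ _⟩

theorem IsWeaklySingular.intervalIntegrable (hK : IsWeaklySingular K L) {T : ℝ} (hT : T ≤ 1)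
    {u : ℝ → X} (hu : ContinuousOn u (Ioc 0 T)) {R : ℝ} (hR : ∀ s ∈ Ioc 0 T, ‖u s‖ ≤ R)
    {t : ℝ} (ht : t ∈ Ioc 0 T) :
    IntervalIntegrable (fun s => K (t - s) (u s)) volume 0 t := by
  rw [intervalIntegrable_iff_integrableOn_Ioo_of_le ht.1.le]
  have hi := (intervalIntegrable_iff_integrableOn_Ioo_of_le ht.1.le).1
    ((intervalIntegrable_sub_rpow t 0).const_mul (L R * R))
  refine hi.mono' ((hK.continuousOn_comp hu ht).aestronglyMeasurable measurableSet_Ioo) ?_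
  refine (ae_restrict_iff' measurableSet_Ioo).2 (Eventually.of_forall fun s hs => ?_)
  exact hK.norm_le (sub_pos.2 hs.2) (by linarith [hs.1, ht.2])
    (hR s ⟨hs.1, hs.2.le.trans ht.2⟩)

variable [NormedSpace ℝ X]

/-- The Volterra operator of a kernel. -/
def volterra (K : ℝ → X → X) (u : ℝ → X) (t : ℝ) : X := ∫ s in (0 : ℝ)..t, K (t - s) (u s)

/-- Only `(a, t)` contributes, and `2 (t - a)^{1/2}` is the integral of the singularity over it.
Taking `a = 0` serves the contraction; `a > 0` lets uniqueness continue past an interval already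
settled. -/
theorem IsWeaklySingular.norm_volterra_sub_le (hK : IsWeaklySingular K L) {T : ℝ} (hT : T ≤ 1)
    {u v : ℝ → X} (hu : ContinuousOn u (Ioc 0 T)) (hv : ContinuousOn v (Ioc 0 T)) {R : ℝ}
    (huR : ∀ s ∈ Ioc 0 T, ‖u s‖ ≤ R) (hvR : ∀ s ∈ Ioc 0 T, ‖v s‖ ≤ R)
    {t a D : ℝ} (ht : t ∈ Ioc 0 T) (ha : 0 ≤ a) (hat : a ≤ t)
    (heq : ∀ s ∈ Ioc 0 a, u s = v s) (hD : ∀ s ∈ Ioc 0 t, ‖u s - v s‖ ≤ D) :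
    ‖volterra K u t - volterra K v t‖ ≤ 2 * L R * (t - a) ^ (1 / 2 : ℝ) * D := by
  have hR0 : 0 ≤ R := (norm_nonneg _).trans (huR t ht)
  have hL := hK.nonneg R hR0
  have iu := hK.intervalIntegrable hT hu huR ht
  have iv := hK.intervalIntegrable hT hv hvR ht
  have isub := iu.sub iv
  have sub1 : uIcc 0 a ⊆ uIcc 0 t := by
    rw [uIcc_of_le ha, uIcc_of_le (ha.trans hat)]; exact Icc_subset_Icc le_rfl hat
  have sub2 : uIcc a t ⊆ uIcc 0 t := by
    rw [uIcc_of_le hat, uIcc_of_le (ha.trans hat)]; exact Icc_subset_Icc ha le_rfl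
  have h0 : ∫ s in (0 : ℝ)..a, (K (t - s) (u s) - K (t - s) (v s)) = 0 := by
    rw [intervalIntegral.integral_of_le ha]
    refine setIntegral_eq_zero_of_forall_eq_zero fun s hs => ?_
    rw [heq s hs, sub_self]
  unfold volterra
  rw [← intervalIntegral.integral_sub iu iv,
    ← intervalIntegral.integral_add_adjacent_intervals (isub.mono_set sub1) (isub.mono_set sub2),
    h0, zero_add]
  calc _ ≤ ∫ s in a..t, L R * D * (t - s) ^ (-(1 / 2) : ℝ) := by
        refine intervalIntegral.norm_integral_le_of_norm_le hat ?_
          ((intervalIntegrable_sub_rpow t a).const_mul _)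
        have hne : ∀ᵐ s : ℝ, s ≠ t := by
          simp [ae_iff]
        filter_upwards [hne] with s hst hs
        have hs0 : 0 < s := ha.trans_lt hs.1
        have hlt : s < t := lt_of_le_of_ne hs.2 hst
        have hsT : s ∈ Ioc 0 T := ⟨hs0, hs.2.trans ht.2⟩
        refine (hK.lipschitz R _ _ _ (sub_pos.2 hlt) (by linarith [ht.2]) (huR s hsT)
          (hvR s hsT)).trans ?_
        have := Real.rpow_nonneg (sub_pos.2 hlt).le (-(1 / 2))
        calc _ ≤ L R * (t - s) ^ (-(1 / 2) : ℝ) * D := by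
              gcongr
              exact hD s ⟨hs0, hs.2⟩
          _ = _ := by ring
    _ = 2 * L R * (t - a) ^ (1 / 2 : ℝ) * D := by
        rw [intervalIntegral.integral_const_mul, integral_sub_rpow]
        ring

theorem IsWeaklySingular.norm_volterra_le (hK : IsWeaklySingular K L) {T : ℝ} (hT : T ≤ 1)
    {u : ℝ → X} (hu : ContinuousOn u (Ioc 0 T)) {R : ℝ}
    (huR : ∀ s ∈ Ioc 0 T, ‖u s‖ ≤ R) {t : ℝ} (ht : t ∈ Ioc 0 T) :
    ‖volterra K u t‖ ≤ 2 * L R * t ^ (1 / 2 : ℝ) * R := by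
  have hR0 : 0 ≤ R := (norm_nonneg _).trans (huR t ht)
  have h := hK.norm_volterra_sub_le hT hu (v := fun _ => 0) continuousOn_const huR
    (fun s _ => by simpa using hR0) ht le_rfl ht.1.le (fun s hs => absurd hs.1 hs.2.not_gt)
    (D := R) (fun s hs => by simpa using huR s ⟨hs.1, hs.2.trans ht.2⟩)
  simpa [volterra, hK.zero] using h

/-- Substituting `r = t - s` pins the singularity at `r = 0`, and an indicator fixes the domain of
integration. Dominated convergence then applies with a majorant `r^{-1/2}` independent of `t`;
continuity in `t` can fail only at `r = t₀`, a null set. -/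
theorem IsWeaklySingular.continuousOn_volterra (hK : IsWeaklySingular K L) {T : ℝ} (hT : T ≤ 1)
    {u : ℝ → X} (hu : ContinuousOn u (Ioc 0 T)) {R : ℝ}
    (huR : ∀ s ∈ Ioc 0 T, ‖u s‖ ≤ R) : ContinuousOn (volterra K u) (Ioc 0 T) := by
  intro t₀ ht₀
  have hT0 : 0 < T := ht₀.1.trans_le ht₀.2
  set F : ℝ → ℝ → X := fun t => (Ioo 0 t).indicator fun r => K r (u (t - r)) with hF
  have hcont : ∀ t ∈ Ioc 0 T, ContinuousOn (fun r => K r (u (t - r))) (Ioo 0 t) := by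
    intro t ht
    refine hK.continuousOn.comp (f := fun r => (r, u (t - r))) ?_ fun r hr => ?_
    · refine continuousOn_id.prodMk (hu.comp (continuousOn_const.sub continuousOn_id) ?_)
      intro r hr
      exact ⟨sub_pos.2 hr.2, by change t - r ≤ T; linarith [hr.1, ht.2]⟩
    · exact ⟨hr.1, mem_univ _⟩
  have hV : ∀ t ∈ Ioc 0 T, volterra K u t = ∫ r in (0 : ℝ)..T, F t r := by
    intro t ht
    have h1 : volterra K u t = ∫ r in (0 : ℝ)..t, K r (u (t - r)) := by
      have := intervalIntegral.integral_comp_sub_left (a := 0) (b := t)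
        (fun r => K r (u (t - r))) t
      simpa [volterra] using this
    rw [h1, intervalIntegral.integral_of_le ht.1.le, intervalIntegral.integral_of_le hT0.le,
      integral_Ioc_eq_integral_Ioo, hF, setIntegral_indicator measurableSet_Ioo]
    congr 2
    ext r
    exact ⟨fun h => ⟨⟨h.1, h.2.le.trans ht.2⟩, h⟩, fun h => h.2⟩
  have key : ContinuousWithinAt (fun t => ∫ r in (0 : ℝ)..T, F t r) (Ioc 0 T) t₀ := by
    refine intervalIntegral.continuousWithinAt_of_dominated_interval
      (bound := fun r => L R * R * r ^ (-(1 / 2) : ℝ)) ?_ ?_ ?_ ?_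
    · filter_upwards [self_mem_nhdsWithin] with t ht
      exact ((aestronglyMeasurable_indicator_iff measurableSet_Ioo).2
        ((hcont t ht).aestronglyMeasurable measurableSet_Ioo)).mono_measure Measure.restrict_le_self
    · filter_upwards [self_mem_nhdsWithin] with t ht
      refine Eventually.of_forall fun r hr => ?_
      rw [uIoc_of_le hT0.le] at hr
      by_cases h : r ∈ Ioo 0 t
      · rw [hF]
        simp only [indicator_of_mem h]
        exact hK.norm_le hr.1 (hr.2.trans hT) (huR _ ⟨sub_pos.2 h.2, by linarith [ht.2, h.1]⟩)
      · rw [hF]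
        simp only [indicator_of_notMem h, norm_zero]
        have := hK.nonneg R ((norm_nonneg _).trans (huR t ht))
        have := (norm_nonneg _).trans (huR t ht)
        have := Real.rpow_nonneg hr.1.le (-(1 / 2))
        positivity
    · exact (intervalIntegral.intervalIntegrable_rpow' (by norm_num)).const_mul _
    · have hne : ∀ᵐ r : ℝ, r ≠ t₀ := by simp [ae_iff]
      filter_upwards [hne] with r hrt hr
      rw [uIoc_of_le hT0.le] at hr
      rcases lt_or_gt_of_ne hrt with h | h
      · have hmem : ∀ᶠ t in 𝓝[Ioc 0 T] t₀, r < t :=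
          nhdsWithin_le_nhds (lt_mem_nhds h)
        have h1 : ContinuousWithinAt (fun t => K r (u (t - r))) (Ioc 0 T ∩ Ioi r) t₀ := by
          refine ContinuousWithinAt.comp (f := fun t => (r, u (t - r)))
            (t := Ioi 0 ×ˢ univ) (hK.continuousOn (r, u (t₀ - r)) ⟨hr.1, mem_univ _⟩) ?_
            fun t _ => ⟨hr.1, mem_univ _⟩
          refine continuousWithinAt_const.prodMk ?_
          refine ContinuousWithinAt.comp (f := fun t => t - r) (t := Ioc 0 T)
            (hu _ ⟨sub_pos.2 h, by linarith [ht₀.2, hr.1]⟩)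
            (continuousWithinAt_id.sub continuousWithinAt_const) ?_
          intro t ht
          exact ⟨sub_pos.2 ht.2, by linarith [ht.1.2, hr.1]⟩
        have h2 := (continuousWithinAt_inter (Ioi_mem_nhds h)).1 h1
        refine h2.congr_of_eventuallyEq ?_ ?_
        · filter_upwards [hmem] with t ht
          simp only [hF]
          rw [indicator_of_mem (show r ∈ Ioo 0 t from ⟨hr.1, ht⟩)]
        · simp only [hF]
          rw [indicator_of_mem (show r ∈ Ioo 0 t₀ from ⟨hr.1, h⟩)]
      · refine (continuousWithinAt_const (b := (0 : X))).congr_of_eventuallyEq ?_ ?_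
        · filter_upwards [nhdsWithin_le_nhds (gt_mem_nhds h)] with t ht
          simp only [hF]
          rw [indicator_of_notMem fun h' => lt_asymm ht h'.2]
        · simp only [hF]
          rw [indicator_of_notMem fun h' => lt_asymm h h'.2]
  exact key.congr (fun t ht => hV t ht) (hV t₀ ht₀)

/-- On a step of length `δ` the Volterra difference at least halves any bound for `u - v`. Iterating
from the bound `2R` gives zero on that step, and induction over the steps covers `(0,T]`. -/
theorem eqOn_of_volterra (hK : IsWeaklySingular K L) {T : ℝ} (hT : T ≤ 1)
    {u v : ℝ → X} (hu : ContinuousOn u (Ioc 0 T)) (hv : ContinuousOn v (Ioc 0 T))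
    {R : ℝ} (huR : ∀ s ∈ Ioc 0 T, ‖u s‖ ≤ R) (hvR : ∀ s ∈ Ioc 0 T, ‖v s‖ ≤ R) {a : ℝ → X}
    (hua : ∀ t ∈ Ioc 0 T, u t = a t - volterra K u t)
    (hva : ∀ t ∈ Ioc 0 T, v t = a t - volterra K v t) : EqOn v u (Ioc 0 T) := by
  rcases le_or_gt T 0 with hT0 | hT0
  · intro t ht
    exact absurd (ht.1.trans_le ht.2) hT0.not_gt
  have hR0 : 0 ≤ R := (norm_nonneg _).trans (huR T ⟨hT0, le_rfl⟩)
  have hL := hK.nonneg R hR0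
  obtain ⟨δ, hδ, hδL⟩ : ∃ δ : ℝ, 0 < δ ∧ 2 * L R * δ ^ (1 / 2 : ℝ) ≤ 1 / 2 := by
    -- The square cancels the root, leaving `2 L R / (4 (L R + 1)) ≤ 1/2`; the `+ 1` covers `L R =
    -- 0`.
    refine ⟨(1 / (4 * (L R + 1))) ^ 2, by positivity, ?_⟩
    rw [← Real.sqrt_eq_rpow, Real.sqrt_sq (by positivity), mul_one_div, div_le_iff₀ (by positivity)]
    linarith
  have hstep : ∀ n : ℕ, ∀ t ∈ Ioc 0 T, t ≤ n * δ → u t = v t := by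
    intro n
    induction n with
    | zero =>
      intro t ht h
      simp only [Nat.cast_zero, zero_mul] at h
      exact absurd ht.1 h.not_gt
    | succ n ih =>
      have hm : ∀ m : ℕ, ∀ t ∈ Ioc 0 T, t ≤ (n + 1) * δ →
          ‖u t - v t‖ ≤ (1 / 2) ^ m * (2 * R) := by
        intro m
        induction m with
        | zero =>
          intro t ht _
          have := norm_sub_le (u t) (v t)
          linarith [huR t ht, hvR t ht]
        | succ m ihm =>
          intro t ht hle
          rcases le_or_gt t (n * δ) with h | h
          · rw [ih t ht h, sub_self, norm_zero]
            positivity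
          · have key := hK.norm_volterra_sub_le hT hu hv huR hvR ht (a := n * δ) (by positivity)
              h.le (fun s hs => ih s ⟨hs.1, (hs.2.trans h.le).trans ht.2⟩ hs.2)
              (fun s hs => ihm s ⟨hs.1, hs.2.trans ht.2⟩ (hs.2.trans hle))
            rw [hua t ht, hva t ht, sub_sub_sub_cancel_left, norm_sub_rev]
            refine key.trans ?_
            have h1 : (t - n * δ) ^ (1 / 2 : ℝ) ≤ δ ^ (1 / 2 : ℝ) :=
              Real.rpow_le_rpow (by linarith) (by linarith) (by norm_num)
            have h2 : 2 * L R * (t - n * δ) ^ (1 / 2 : ℝ) ≤ 1 / 2 :=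
              le_trans (by gcongr) hδL
            calc _ ≤ 1 / 2 * ((1 / 2) ^ m * (2 * R)) := by gcongr
              _ = _ := by ring
      intro t ht hle
      have hlim : Tendsto (fun m : ℕ => (1 / 2 : ℝ) ^ m * (2 * R)) atTop (𝓝 0) := by
        have := (tendsto_pow_atTop_nhds_zero_of_lt_one (r := (1 / 2 : ℝ)) (by norm_num)
          (by norm_num)).mul_const (2 * R)
        simpa using this
      have := ge_of_tendsto' hlim fun m => hm m t ht (by simpa using hle)
      exact sub_eq_zero.1 (norm_le_zero_iff.1 this)
  intro t ht
  obtain ⟨n, hn⟩ := exists_nat_ge (t / δ)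
  exact (hstep n t ht ((div_le_iff₀ hδ).1 hn)).symm

/-- Banach's fixed point theorem in the ball of radius `R = 2A`, which is preserved since `A + R/2 =
R`. The time `T` depends only on `L` and `A`, not on the particular `a`. -/
theorem exists_volterra [CompleteSpace X] (hK : IsWeaklySingular K L) {A : ℝ} (hA : 0 ≤ A) :
    ∃ T : ℝ, 0 < T ∧ T ≤ 1 ∧ ∀ a : ℝ → X, ContinuousOn a (Ioc 0 T) →
      (∀ t ∈ Ioc 0 T, ‖a t‖ ≤ A) → ∃ u : ℝ → X, ContinuousOn u (Ioc 0 T) ∧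
        (∃ R, ∀ t ∈ Ioc 0 T, ‖u t‖ ≤ R) ∧ ∀ t ∈ Ioc 0 T, u t = a t - volterra K u t := by
  set R := 2 * A with hR
  have hR0 : 0 ≤ R := by positivity
  have hL := hK.nonneg R hR0
  obtain ⟨T, hT0, hT1, hTL⟩ : ∃ T : ℝ, 0 < T ∧ T ≤ 1 ∧ 2 * L R * T ^ (1 / 2 : ℝ) ≤ 1 / 2 := by
    refine ⟨(1 / (4 * (L R + 1))) ^ 2, by positivity, ?_, ?_⟩
    · apply pow_le_one₀ (by positivity)
      rw [div_le_one (by positivity)]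
      linarith
    · rw [← Real.sqrt_eq_rpow, Real.sqrt_sq (by positivity), mul_one_div,
        div_le_iff₀ (by positivity)]
      linarith
  refine ⟨T, hT0, hT1, fun a ha haA => ?_⟩
  have hTt : ∀ t ∈ Ioc 0 T, 2 * L R * t ^ (1 / 2 : ℝ) ≤ 1 / 2 := fun t ht =>
    le_trans (by gcongr; exacts [ht.1.le, ht.2]) hTL
  -- The interval is half-open because `a` is not assumed to have a limit at zero.
  set Y := Metric.closedBall (0 : BoundedContinuousFunction (Ioc 0 T) X) R
  classical
  let ext : BoundedContinuousFunction (Ioc 0 T) X → ℝ → X := fun w s =>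
    if h : s ∈ Ioc 0 T then w ⟨s, h⟩ else 0
  have hext : ∀ w (t : Ioc 0 T), ext w t = w t := fun w t => by simp only [ext, dif_pos t.2]
  have hextc : ∀ w, ContinuousOn (ext w) (Ioc 0 T) := fun w => by
    rw [continuousOn_iff_continuous_domRestrict]
    exact w.continuous.congr fun t => (hext w t).symm
  have hextR : ∀ w : Y, ∀ t ∈ Ioc 0 T, ‖ext w.1 t‖ ≤ R := fun w t ht => by
    rw [hext w.1 ⟨t, ht⟩]
    have := w.2
    rw [mem_closedBall_zero_iff] at this
    exact (w.1.norm_coe_le_norm _).trans this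
  have hbound : ∀ w : Y, ∀ t ∈ Ioc 0 T, ‖a t - volterra K (ext w.1) t‖ ≤ R := fun w t ht => by
    have h1 := hK.norm_volterra_le hT1 (hextc w.1) (hextR w) ht
    have h2 := norm_sub_le (a t) (volterra K (ext w.1) t)
    have h3 := mul_le_mul_of_nonneg_right (hTt t ht) hR0
    linarith [haA t ht]
  let Φ₀ : Y → BoundedContinuousFunction (Ioc 0 T) X := fun w =>
    BoundedContinuousFunction.ofNormedAddCommGroup
      (fun t : Ioc 0 T => a t - volterra K (ext w.1) t)
      (continuousOn_iff_continuous_domRestrict.1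
        (ha.sub (hK.continuousOn_volterra hT1 (hextc w.1) (hextR w)))) R
      (fun t => hbound w t t.2)
  let Φ : Y → Y := fun w => ⟨Φ₀ w, by
    rw [mem_closedBall_zero_iff]
    exact BoundedContinuousFunction.norm_ofNormedAddCommGroup_le _ hR0 _⟩
  have hΦ : ContractingWith (1 / 2) Φ := by
    refine ⟨by
      rw [← NNReal.coe_lt_coe]
      norm_num, LipschitzWith.of_dist_le_mul fun w w' => ?_⟩
    rw [Subtype.dist_eq, Subtype.dist_eq, BoundedContinuousFunction.dist_le (by positivity)]
    intro t
    have hD : ∀ s ∈ Ioc 0 (t : ℝ), ‖ext w.1 s - ext w'.1 s‖ ≤ dist w.1 w'.1 := fun s hs => by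
      have hs' : s ∈ Ioc 0 T := ⟨hs.1, hs.2.trans t.2.2⟩
      rw [hext w.1 ⟨s, hs'⟩, hext w'.1 ⟨s, hs'⟩, ← dist_eq_norm]
      exact BoundedContinuousFunction.dist_coe_le_dist _
    have key := hK.norm_volterra_sub_le hT1 (hextc w.1) (hextc w'.1) (hextR w) (hextR w') t.2
      le_rfl t.2.1.le (fun s hs => absurd hs.1 hs.2.not_gt) hD
    rw [sub_zero] at key
    change dist (a t - volterra K (ext w.1) t) (a t - volterra K (ext w'.1) t) ≤ _
    rw [dist_sub_left, dist_eq_norm]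
    refine key.trans ?_
    have := mul_le_mul_of_nonneg_right (hTt t t.2) (dist_nonneg (x := w.1) (y := w'.1))
    simpa using this
  have : Nonempty Y := ⟨⟨0, by simp [Y, hR0]⟩⟩
  have : CompleteSpace Y := Metric.isClosed_closedBall.completeSpace_coe
  set w := ContractingWith.fixedPoint Φ hΦ with hw
  have hfix : Φ w = w := hΦ.fixedPoint_isFixedPt
  refine ⟨ext w.1, hextc _, ⟨R, hextR w⟩, fun t ht => ?_⟩
  calc ext w.1 t = w.1 ⟨t, ht⟩ := hext w.1 ⟨t, ht⟩
    _ = (Φ w).1 ⟨t, ht⟩ := by rw [hfix]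
    _ = a t - volterra K (ext w.1) t := rfl

end Volterra

/-! ### Behaviour of the free evolution at time zero. -/

/-- `Δ²e^{-sΔ²}` of an element of `W^{1,∞}`, with one derivative falling on the element. -/
def bilaplaceHeat (w : W1Inf) (s : ℝ) : Lp ℝ ∞ vol :=
  ∑ i, ∑ j, op [i, i, j] s (comp j (grad w))

theorem coef_bilaplaceHeat (w : W1Inf) {s : ℝ} (hs : 0 < s) (k : Fin 2 → ℤ) :
    coef k (bilaplaceHeat w s) =
      (((2 * Real.pi) ^ 4 * ((k 0 : ℝ) ^ 2 + (k 1 : ℝ) ^ 2) ^ 2 *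
        Real.exp (-s * ((2 * Real.pi) ^ 4 * ((k 0 : ℝ) ^ 2 + (k 1 : ℝ) ^ 2) ^ 2)) : ℝ) : ℂ)
        * coef k (fn w) := by
  simp only [bilaplaceHeat, Fin.sum_univ_two, map_add, coef_op_cons, coef_op [] hs, coef_comp_grad,
    sym, List.map_nil, List.prod_nil, one_mul]
  push_cast
  rw [← mul_assoc (-(s : ℂ))]
  generalize Complex.exp _ = e
  have hI : Complex.I ^ 4 = 1 := Complex.I_pow_four
  linear_combination (16 * (Real.pi : ℂ) ^ 4 * ((k 0 : ℂ) ^ 2 + (k 1 : ℂ) ^ 2) ^ 2 * e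
    * coef k (fn w)) * hI

/-- Three derivatives fall on the kernel and the fourth on `w`, giving an integrable rate. With all
four on the kernel the bound would be `s^{-1}`, just short of integrable. -/
theorem exists_norm_bilaplaceHeat_le (w : W1Inf) :
    ∃ C : ℝ, ∀ s, 0 < s → ‖bilaplaceHeat w s‖ ≤ C * s ^ (-(3 / 4) : ℝ) := by
  refine ⟨∑ i : Fin 2, ∑ j : Fin 2, (∫ z, ‖kernel [i, i, j] z‖) * ‖comp j (grad w)‖,
    fun s hs => ?_⟩
  simp only [Finset.sum_mul]
  refine norm_sum_le_of_le _ fun i _ => norm_sum_le_of_le _ fun j _ => ?_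
  refine (ContinuousLinearMap.le_of_opNorm_le _ (norm_op_le [i, i, j] hs) _).trans_eq ?_
  have : (-(([i, i, j] : List (Fin 2)).length : ℝ) / 4) = -(3 / 4) := by
    simp; norm_num
  rw [this]
  ring

theorem continuousOn_bilaplaceHeat (w : W1Inf) : ContinuousOn (bilaplaceHeat w) (Ioi 0) :=
  continuousOn_finsetSum _ fun i _ => continuousOn_finsetSum _ fun j _ =>
    (continuousOn_op [i, i, j]).clm_apply continuousOn_const

theorem intervalIntegrable_bilaplaceHeat (w : W1Inf) {b : ℝ} (hb : 0 < b) :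
    IntervalIntegrable (bilaplaceHeat w) volume 0 b := by
  obtain ⟨C, hC⟩ := exists_norm_bilaplaceHeat_le w
  have hi : IntervalIntegrable (fun s : ℝ => C * s ^ (-(3 / 4) : ℝ)) volume 0 b :=
    (intervalIntegral.intervalIntegrable_rpow' (by norm_num)).const_mul _
  rw [intervalIntegrable_iff_integrableOn_Ioc_of_le hb.le] at hi ⊢
  refine hi.mono' (((continuousOn_bilaplaceHeat w).mono fun s hs => hs.1).aestronglyMeasurable
    measurableSet_Ioc) ?_
  exact (ae_restrict_iff' measurableSet_Ioc).2 (Eventually.of_forall fun s hs => hC s hs.1)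

/-- Coefficients commute with the Bochner integral, so this is the fundamental theorem of calculus
for `e^{-sm}` at each frequency. -/
theorem sub_op_nil_eq_integral (w : W1Inf) {b : ℝ} (hb : 0 < b) :
    fn w - op [] b (fn w) = ∫ s in (0 : ℝ)..b, bilaplaceHeat w s := by
  refine ext_coef fun k => ?_
  set m : ℝ := (2 * Real.pi) ^ 4 * ((k 0 : ℝ) ^ 2 + (k 1 : ℝ) ^ 2) ^ 2 with hm
  rw [← (coef k).intervalIntegral_comp_comm (intervalIntegrable_bilaplaceHeat w hb)]
  have h1 : ∫ s in (0 : ℝ)..b, coef k (bilaplaceHeat w s)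
      = ∫ s in (0 : ℝ)..b, ((m * Real.exp (-s * m) : ℝ) : ℂ) * coef k (fn w) := by
    refine intervalIntegral.integral_congr_ae (Eventually.of_forall fun s hs => ?_)
    rw [uIoc_of_le hb.le] at hs
    exact coef_bilaplaceHeat w hs.1 k
  have h2 : ∫ s in (0 : ℝ)..b, m * Real.exp (-s * m) = 1 - Real.exp (-b * m) := by
    have hd : ∀ s ∈ uIcc 0 b,
        HasDerivAt (fun s => -Real.exp (-s * m)) (m * Real.exp (-s * m)) s := by
      intro s _
      have : HasDerivAt (fun s : ℝ => -s * m) (-1 * m) s := ((hasDerivAt_id s).neg).mul_const m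
      refine this.exp.neg.congr_deriv ?_
      ring
    rw [intervalIntegral.integral_eq_sub_of_hasDerivAt hd
      (Continuous.intervalIntegrable (by fun_prop) _ _)]
    simp
    ring
  rw [h1, intervalIntegral.integral_mul_const, intervalIntegral.integral_ofReal, h2, map_sub,
    coef_op [] hb]
  simp only [sym, List.map_nil, List.prod_nil, one_mul]
  rw [mul_assoc (-b), ← hm]
  push_cast
  ring

/-- On `W^{1,∞}` the semigroup is continuous at zero with values in `L^∞`. -/
theorem tendsto_op_nil_fn (w : W1Inf) :
    Tendsto (fun τ => op [] τ (fn w)) (𝓝[>] 0) (𝓝 (fn w)) := by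
  obtain ⟨C, hC⟩ := exists_norm_bilaplaceHeat_le w
  rw [tendsto_iff_norm_sub_tendsto_zero]
  have hlim : Tendsto (fun b : ℝ => C * (4 * b ^ (1 / 4 : ℝ))) (𝓝[>] 0) (𝓝 0) := by
    have : Continuous (fun b : ℝ => C * (4 * b ^ (1 / 4 : ℝ))) :=
      continuous_const.mul (continuous_const.mul
        (Real.continuous_rpow_const (by norm_num)))
    have h := this.tendsto 0
    rw [Real.zero_rpow (by norm_num), mul_zero, mul_zero] at h
    exact h.mono_left nhdsWithin_le_nhds
  refine squeeze_zero' (Eventually.of_forall fun _ => norm_nonneg _) ?_ hlim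
  filter_upwards [self_mem_nhdsWithin] with b (hb : 0 < b)
  rw [norm_sub_rev, sub_op_nil_eq_integral w hb]
  have h1 : ‖∫ s in (0 : ℝ)..b, bilaplaceHeat w s‖ ≤ ∫ s in (0 : ℝ)..b, C * s ^ (-(3 / 4) : ℝ) := by
    refine intervalIntegral.norm_integral_le_of_norm_le hb.le
      (Eventually.of_forall fun s hs => hC s hs.1)
      ((intervalIntegral.intervalIntegrable_rpow' (by norm_num)).const_mul _)
  refine h1.trans_eq ?_
  rw [intervalIntegral.integral_const_mul, integral_rpow (Or.inl (by norm_num))]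
  norm_num
  left
  ring

theorem tendsto_W1Inf {l : Filter ℝ} {u : ℝ → W1Inf} {w : W1Inf}
    (h1 : Tendsto (fun t => fn (u t)) l (𝓝 (fn w)))
    (h2 : Tendsto (fun t => grad (u t)) l (𝓝 (grad w))) : Tendsto u l (𝓝 w) :=
  tendsto_subtype_rng.2 (h1.prodMk_nhds h2)

/-- The semigroup acts componentwise on the gradient, whose components have continuous
representatives, so the approximate identity argument applies to each. -/
theorem tendsto_heat_of_isC1 {w : W1Inf} (hw : IsC1 w) :
    Tendsto (fun τ => heat τ w) (𝓝[>] 0) (𝓝 w) := by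
  obtain ⟨g, hg⟩ := hw
  refine tendsto_W1Inf (tendsto_op_nil_fn w) ?_
  simp only [grad_heat]
  rw [← sum_incl_comp (grad w)]
  refine tendsto_finsetSum _ fun i _ => ((incl i).continuous.tendsto _).comp ?_
  rw [sum_incl_comp]
  refine tendsto_op_nil_of_continuous ⟨fun x => g x i, by fun_prop⟩ ?_
  filter_upwards [coeFn_comp i (grad w), hg] with x h1 h2
  rw [h1, h2]
  rfl

/-! ### Mild solutions as solutions of a Volterra equation. -/

/-- The map `w ↦ ∇·e^{-τΔ²}(|∇w|^{p-2}∇w)`. -/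
def nonlin {p : ℝ} (hp2 : 2 < p) (τ : ℝ) (w : W1Inf) : W1Inf := divHeat τ (fluxLp hp2 (grad w))

theorem exists_isWeaklySingular_nonlin {p : ℝ} (hp2 : 2 < p) (hp3 : p < 3) :
    ∃ L, IsWeaklySingular (nonlin hp2) L := by
  obtain ⟨C, hC0, hC⟩ := exists_norm_divHeat_le
  refine ⟨fun R => C * (2 * R ^ (p - 2)), ?_, fun R hR => by positivity, fun τ => ?_, ?_⟩
  · refine continuousOn_divHeat.comp
      (f := fun q : ℝ × W1Inf => (q.1, fluxLp hp2 (grad q.2))) ?_ fun q hq => ⟨hq.1, mem_univ _⟩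
    exact (continuous_fst.prodMk ((continuous_fluxLp hp2 hp3).comp
      (continuous_grad.comp continuous_snd))).continuousOn
  · have : grad 0 = 0 := rfl
    rw [nonlin, this, fluxLp_zero, map_zero]
  · intro R τ w w' hτ hτ1 hw hw'
    rw [nonlin, nonlin, ← map_sub]
    have hr := Real.rpow_nonneg hτ.le (-(1 / 2))
    have h1 := norm_fluxLp_sub_le hp2 hp3 ((norm_grad_le w).trans hw) ((norm_grad_le w').trans hw')
    have h2 : ‖grad w - grad w'‖ ≤ ‖w - w'‖ := norm_grad_le (w - w')
    have hR : 0 ≤ R := (norm_nonneg _).trans hw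
    calc _ ≤ C * τ ^ (-(1 / 2) : ℝ) * ‖fluxLp hp2 (grad w) - fluxLp hp2 (grad w')‖ := hC τ hτ hτ1 _
      _ ≤ C * τ ^ (-(1 / 2) : ℝ) * (2 * R ^ (p - 2) * ‖w - w'‖) := by
          refine mul_le_mul_of_nonneg_left (h1.trans ?_) (mul_nonneg hC0 hr)
          exact mul_le_mul_of_nonneg_left h2 (by positivity)
      _ = _ := by ring

theorem volterra_congr {X : Type*} [NormedAddCommGroup X] [NormedSpace ℝ X] (K : ℝ → X → X)
    {u v : ℝ → X} {t : ℝ} (ht : 0 < t) (h : ∀ s ∈ Ioc 0 t, u s = v s) :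
    volterra K u t = volterra K v t := by
  refine intervalIntegral.integral_congr_ae (Eventually.of_forall fun s hs => ?_)
  rw [uIoc_of_le ht.le] at hs
  rw [h s hs]

/-- Any witnesses `a` and `N` are forced by `fn_injective`, the latter for `s < t`, hence almost
everywhere. Boundedness serves the converse, where it gives integrability of the canonical
integrand. -/
theorem isMildSolution_iff {p : ℝ} (hp2 : 2 < p) (hp3 : p < 3) {T : ℝ} (hT : T ≤ 1) {u₀ : W1Inf}
    {u : ℝ → W1Inf} (hB : BoundedNearZero T u) :
    IsMildSolution p T u₀ u ↔ ContinuousOn u (Ioc 0 T) ∧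
      ∀ t ∈ Ioc 0 T, u t = heat t u₀ - volterra (nonlin hp2) u t := by
  obtain ⟨L, hK⟩ := exists_isWeaklySingular_nonlin hp2 hp3
  have hN : ∀ t s, s ∈ Ioo 0 t → fn (nonlin hp2 (t - s) (u s))
      =ᵐ[vol] divSemigroup (t - s) fun x => flux p (grad (u s) x) := fun t s hs =>
    fn_divHeat_ae_eq (sub_pos.2 hs.2) (coeFn_fluxLp hp2 _)
  refine and_congr_right fun hc => forall₂_congr fun t ht => ⟨?_, fun h => ?_⟩
  · rintro ⟨a, N, ha, hN', -, h⟩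
    have h1 : a = heat t u₀ := fn_injective (Lp.ext (ha.trans (fn_heat_ae_eq ht.1 u₀).symm))
    have h2 : ∫ s in (0 : ℝ)..t, N s = volterra (nonlin hp2) u t := by
      have hne : ∀ᵐ s : ℝ, s ≠ t := by simp [ae_iff]
      refine intervalIntegral.integral_congr_ae ?_
      filter_upwards [hne] with s hst hs
      rw [uIoc_of_le ht.1.le] at hs
      have hs' : s ∈ Ioo 0 t := ⟨hs.1, lt_of_le_of_ne hs.2 hst⟩
      exact fn_injective (Lp.ext ((hN' s hs').trans (hN t s hs').symm))
    rw [h, h1, h2]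
  · obtain ⟨B, hB⟩ := hB
    exact ⟨heat t u₀, fun s => nonlin hp2 (t - s) (u s), fn_heat_ae_eq ht.1 u₀, hN t,
      hK.intervalIntegrable hT hc hB ht, h⟩

theorem continuousOn_Icc_of_tendsto {Y : Type*} [TopologicalSpace Y] {T : ℝ} {f : ℝ → Y}
    (h : ContinuousOn f (Ioc 0 T)) (h0 : Tendsto f (𝓝[>] 0) (𝓝 (f 0))) :
    ContinuousOn f (Icc 0 T) := by
  intro t ht
  rcases ht.1.eq_or_lt with rfl | ht0
  · have : ContinuousWithinAt f (Ici 0) 0 := continuousWithinAt_Ioi_iff_Ici.1 h0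
    exact this.mono fun s hs => hs.1
  · refine (h t ⟨ht0, ht.2⟩).mono_of_mem_nhdsWithin ?_
    filter_upwards [self_mem_nhdsWithin, nhdsWithin_le_nhds (lt_mem_nhds ht0)] with s hs hs0
    exact ⟨hs0, hs.2⟩

end ThinFilm
end

theorem mainTheorem8 (p : ℝ) (hp2 : 2 < p) (hp3 : p < 3) (M : ℝ) :
    ∃ T : ℝ, 0 < T ∧ T ≤ 1 ∧
      ∀ u₀ : ThinFilm.W1Inf, ‖u₀‖ ≤ M →
        ∃ u : ℝ → ThinFilm.W1Inf,
          ThinFilm.IsMildSolution p T u₀ u ∧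
          ThinFilm.BoundedNearZero T u ∧
          u 0 = u₀ ∧
          ContinuousOn (fun t => ThinFilm.fn (u t)) (Icc 0 T) ∧
          (ThinFilm.IsC1 u₀ → ContinuousOn u (Icc 0 T)) ∧
          ∀ v : ℝ → ThinFilm.W1Inf,
            ThinFilm.IsMildSolution p T u₀ v → ThinFilm.BoundedNearZero T v →
              EqOn v u (Ioc 0 T) := by
  obtain ⟨L, hK⟩ := ThinFilm.exists_isWeaklySingular_nonlin hp2 hp3
  obtain ⟨C, hC0, hC⟩ := ThinFilm.exists_norm_heat_le
  -- `C * |M|` bounds the free evolution of all admissible data at once, so `T` is fixed before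
  -- `u₀`; the absolute value keeps it nonnegative for every real `M`.
  obtain ⟨T, hT0, hT1, hT⟩ := ThinFilm.exists_volterra hK (A := C * |M|) (by positivity)
  refine ⟨T, hT0, hT1, fun u₀ hu₀ => ?_⟩
  obtain ⟨u', hc', ⟨R, hR'⟩, heq'⟩ := hT (fun t => ThinFilm.heat t u₀)
    ((ThinFilm.continuousOn_heat u₀).mono fun t ht => ht.1)
    fun t ht => (hC t ht.1 u₀).trans (by gcongr; exact hu₀.trans (le_abs_self M))
  classical
  -- The fixed point carries no information at zero, and `heat 0` is zero by the convention in `op`,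
  -- so the initial value is prescribed by hand. The Volterra integral does not see this change.
  set u : ℝ → ThinFilm.W1Inf := fun t => if 0 < t then u' t else u₀ with hu
  have huu' : ∀ t, 0 < t → u t = u' t := fun t ht => if_pos ht
  have hu0 : u 0 = u₀ := if_neg (lt_irrefl _)
  have hc : ContinuousOn u (Ioc 0 T) := hc'.congr fun t ht => huu' t ht.1
  have hR : ∀ t ∈ Ioc 0 T, ‖u t‖ ≤ R := fun t ht => by rw [huu' t ht.1]; exact hR' t ht
  have heq : ∀ t ∈ Ioc 0 T,
      u t = ThinFilm.heat t u₀ - ThinFilm.volterra (ThinFilm.nonlin hp2) u t := fun t ht => by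
    rw [ThinFilm.volterra_congr _ ht.1 fun s hs => huu' s hs.1, huu' t ht.1]
    exact heq' t ht
  have hev : ∀ᶠ t in 𝓝[>] (0 : ℝ), t ∈ Ioc 0 T := Ioc_mem_nhdsGT hT0
  have hV : Tendsto (ThinFilm.volterra (ThinFilm.nonlin hp2) u) (𝓝[>] 0) (𝓝 0) := by
    have hlim : Tendsto (fun t : ℝ => 2 * L R * t ^ (1 / 2 : ℝ) * R) (𝓝[>] 0) (𝓝 0) := by
      have : Continuous (fun t : ℝ => 2 * L R * t ^ (1 / 2 : ℝ) * R) :=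
        (continuous_const.mul (Real.continuous_rpow_const (by norm_num))).mul continuous_const
      have h := this.tendsto 0
      rw [Real.zero_rpow (by norm_num), mul_zero, zero_mul] at h
      exact h.mono_left nhdsWithin_le_nhds
    refine squeeze_zero_norm' ?_ hlim
    filter_upwards [hev] with t ht
    exact hK.norm_volterra_le hT1 hc hR ht
  refine ⟨u, (ThinFilm.isMildSolution_iff hp2 hp3 hT1 ⟨R, hR⟩).2 ⟨hc, heq⟩, ⟨R, hR⟩, hu0,
    ?_, ?_, ?_⟩
  · refine ThinFilm.continuousOn_Icc_of_tendsto
      (ThinFilm.continuous_fn.comp_continuousOn hc) ?_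
    have h1 := (ThinFilm.tendsto_op_nil_fn u₀).sub ((ThinFilm.continuous_fn.tendsto _).comp hV)
    have h2 : ThinFilm.fn u₀ - ThinFilm.fn 0 = ThinFilm.fn (u 0) := by
      rw [hu0]
      exact sub_zero _
    rw [h2] at h1
    refine h1.congr' ?_
    filter_upwards [hev] with t ht
    rw [heq t ht]
    rfl
  · intro hC1
    refine ThinFilm.continuousOn_Icc_of_tendsto hc ?_
    have h1 := (ThinFilm.tendsto_heat_of_isC1 hC1).sub hV
    rw [sub_zero, ← hu0] at h1
    refine h1.congr' ?_
    filter_upwards [hev] with t ht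
    rw [heq t ht, hu0]
  · rintro v hv ⟨R₂, hR₂⟩
    obtain ⟨hvc, hveq⟩ := (ThinFilm.isMildSolution_iff hp2 hp3 hT1 ⟨R₂, hR₂⟩).1 hv
    -- The bound of `v` may exceed the radius of the contraction ball; uniqueness only needs some
    -- common bound, since its step length adapts to it.
    exact ThinFilm.eqOn_of_volterra hK hT1 hc hvc (R := max R R₂)
      (fun s hs => (hR s hs).trans (le_max_left _ _))
      (fun s hs => (hR₂ s hs).trans (le_max_right _ _)) heq hveq
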